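/- **Proposition 3.3.** Let $0<\alpha<2$, let $\sigma:\mathbb R\to\mathbb R$ satisfy $|\sigma(x)|\le\widetilde M$ for all $x$, where $\widetilde M>0$, and let $T>0$. Put $c(1,\alpha)=\dfrac{\alpha\,\Gamma((1+\alpha)/2)}{2^{1-\alpha}\sqrt\pi\,\Gamma(1-\alpha/2)}$ and $c(x)=c(1,\alpha)|\sigma(x)|^\alpha$, and let $\zeta$ be the Riemann zeta function. Let $u$ be a classical solution on $\mathbb R\times[0,T]$ of the transformed nonlocal Fokker–Planck equation (without drift and Gaussian diffusion) $$u_t(x,t)=c(x)\ \mathrm{P.V.}\!\int_{\mathbb R\setminus\{0\}}\frac{u(x+z,t)-u(x,t)}{|z|^{1+\alpha}}\,dz ,$$ such that $u$ is $C^4$ in $x$ and $C^2$ in $t$, and $u,u_x,u_{xx},u_{xxx},u_{xxxx}$ and $u_{tt}$ are bounded on $\mathbb R\times[0,T]$. For $\Delta t,h>0$ and $J\in\mathbb N$ let $\tilde L=Jh$, $x_j=jh$, $t_n=n\Delta t$. For a grid function $V$ and $|j|<J$ let $$(A_hV)_j=-c(x_j)\,\zeta(\alpha-1)\,h^{-\alpha}(V_{j+1}-2V_j+V_{j-1})+c(x_j)\,h\sum_{k=-J-j,\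 k\ne0}^{J-j}{}^{\!\!\!\!\!\prime\prime}\ \frac{V_{j+k}-V_j}{|x_k|^{1+\alpha}},$$ where $\sum''$ means that the terms of both end indices are multiplied by $\tfrac12$. The explicit scheme with natural far-field condition on $(-\tilde L,\tilde L)$ is $$U_j^{0}=u(x_j,0),\qquad U_j^{n+1}=U_j^n+\Delta t\,(A_hU^n)_j\qquad(|j|<J),\qquad U_j^n=0\quad(|j|\ge J),$$ its truncation error is $T_j^n=\dfrac{u(x_j,t_{n+1})-u(x_j,t_n)}{\Delta t}-\big(A_hu(\cdot,t_n)\big)_j$, where $A_h$ is applied to the grid values $u(x_i,t_n)$, $i\in\mathbb Z$, and the CFL condition is $$\frac{\Delta t}{h^\alpha}\le\frac1{2\widetilde M^\alpha c(1,\alpha)\,[\,1+\frac1\alpha-\zeta(\alpha-1)\,]} .$$ Then there is a constant $C$, independent of $\Delta t,h,J,n,j$, such that for all $\Delta t>0$, $0<h\le1$ and $J\in\mathbb N$ with $\tilde L=Jh\ge1$: 1. $|T_j^n|\le C(\Delta t+h^2+\tilde L^{-\alpha})$ whenever $x_j\in[-\tilde L/2,\tilde L/2]$ and $t_{n+1}\le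 T$; 2. if the CFL condition holds, then $|U_j^n-u(x_j,t_n)|\le C(\Delta t+h^2+\tilde L^{-\alpha})$ whenever $x_j\in[-\tilde L/2,\tilde L/2]$ and $t_n\le T$. In particular, along every sequence of parameters $(\Delta t_m,h_m,J_m)$ that satisfies the CFL condition and has $\Delta t_m\to0$, $h_m\to0$ and $\tilde L_m=J_mh_m\to\infty$, the numerical solution converges to $u$, uniformly over the grid points $x_j\in[-\tilde L_m/2,\tilde L_m/2]$ and the times $t_n\in[0,T]$. -/

import Mathlib

open Set Filter Topology MeasureTheory

noncomputable section

namespace NonlocalFPE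

/-- The normalising constant `c(1, α)` of the one-dimensional symmetric `α`-stable Lévy measure
`c(1, α) |z|^{-1-α} dz`. -/
def stableConst (α : ℝ) : ℝ :=
  α * Real.Gamma ((1 + α) / 2) / ((2 : ℝ) ^ (1 - α) * √Real.pi * Real.Gamma (1 - α / 2))

/-- The real number `ζ(s)` for real `s` (the Riemann zeta function is real on the real axis). -/
def realZeta (s : ℝ) : ℝ := (riemannZeta (s : ℂ)).re

/-- `v` is the Cauchy principal value of `∫_{z ≠ 0} (φ(x+z) - φ(x)) c(1,α) |z|^{-1-α} dz`:
the truncated integrands are integrable and the truncated integrals over `|z| > ε`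
tend to `v` as `ε ↓ 0`. -/
def HasPVStable (α : ℝ) (φ : ℝ → ℝ) (x v : ℝ) : Prop :=
  (∀ ε : ℝ, 0 < ε →
    IntegrableOn (fun z : ℝ => (φ (x + z) - φ x) * (stableConst α / |z| ^ (1 + α)))
      {z : ℝ | ε < |z|}) ∧
  Tendsto
    (fun ε : ℝ => ∫ z in {z : ℝ | ε < |z|},
      (φ (x + z) - φ x) * (stableConst α / |z| ^ (1 + α)))
    (𝓝[>] 0) (𝓝 v)

/-- `u` (arguments: space, time) is a classical solution on `ℝ × [0, T]` of the transformed
nonlocal Fokker-Planck equation without drift and Gaussian diffusion,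
`u_t(x,t) = |σ(x)|^α P.V. ∫ (u(x+z,t) - u(x,t)) c(1,α) |z|^{-1-α} dz`
(the time derivative is one-sided at `t = 0` and `t = T`). -/
def IsClassicalSolution (α : ℝ) (σ : ℝ → ℝ) (T : ℝ) (u : ℝ → ℝ → ℝ) : Prop :=
  ∀ x : ℝ, ∀ t ∈ Icc (0 : ℝ) T, ∃ v : ℝ,
    HasPVStable α (fun y => u y t) x v ∧
    HasDerivWithinAt (fun s => u x s) (|σ x| ^ α * v) (Icc 0 T) t

/-- `u` is `C²` in time and `C⁴` in space on `ℝ × [0, T]`; the function itself, its space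
derivatives up to order four and its second time derivative are bounded there. -/
def IsRegular (T : ℝ) (u : ℝ → ℝ → ℝ) : Prop :=
  (∀ x : ℝ, ContDiffOn ℝ 2 (fun s => u x s) (Icc 0 T)) ∧
  (∀ t ∈ Icc (0 : ℝ) T, ContDiff ℝ 4 (fun y => u y t)) ∧
  ∃ K : ℝ, ∀ x : ℝ, ∀ t ∈ Icc (0 : ℝ) T,
    (∀ i : ℕ, i ≤ 4 → |iteratedDeriv i (fun y => u y t) x| ≤ K) ∧
    |iteratedDerivWithin 2 (fun s => u x s) (Icc 0 T) t| ≤ K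

/-- The doubly primed sum `∑''_{k = -J-j, k ≠ 0}^{J-j} (U_{j+k} - U_j) / |x_k|^{1+α}`, `x_k = k h`:
the terms of both end indices are multiplied by `1/2`. -/
def primedSum (α h : ℝ) (J : ℕ) (U : ℤ → ℝ) (j : ℤ) : ℝ :=
  ∑ k ∈ (Finset.Icc (-(J : ℤ) - j) ((J : ℤ) - j)).erase 0,
    (if k = -(J : ℤ) - j ∨ k = (J : ℤ) - j then (1 / 2 : ℝ) else 1) *
      ((U (j + k) - U j) / |(k : ℝ) * h| ^ (1 + α))

/-- The spatial discretisation at the grid point `x_j = j h`, on the interval `(-J h, J h)`: the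
modified trapezoidal rule, including the correction with `ζ(α-1)` near the singularity. -/
def discreteOp (α : ℝ) (σ : ℝ → ℝ) (h : ℝ) (J : ℕ) (U : ℤ → ℝ) (j : ℤ) : ℝ :=
  -(stableConst α * |σ ((j : ℝ) * h)| ^ α * realZeta (α - 1) * h ^ (-α) *
      (U (j + 1) - 2 * U j + U (j - 1))) +
    stableConst α * |σ ((j : ℝ) * h)| ^ α * h * primedSum α h J U j

/-- The numerical solution `U^n_j` of the explicit Euler scheme on `(-J h, J h)` with initial
profile `u₀`. The unknowns are the values at the grid points of the open interval (`|j| < J`); by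
the far-field condition the numerical solution is zero at all other grid points. -/
def numSol (α : ℝ) (σ u₀ : ℝ → ℝ) (dt h : ℝ) (J : ℕ) : ℕ → ℤ → ℝ
  | 0, j => if |j| < (J : ℤ) then u₀ ((j : ℝ) * h) else 0
  | n + 1, j =>
    if |j| < (J : ℤ) then
      numSol α σ u₀ dt h J n j + dt * discreteOp α σ h J (numSol α σ u₀ dt h J n) j
    else 0

/-- The CFL condition relating the time step `dt` and the space step `h`, where `Mσ` is a bound
for `|σ|`. -/
def CFL (α Mσ dt h : ℝ) : Prop :=
  dt / h ^ α ≤ 1 / (2 * Mσ ^ α * stableConst α * (1 + 1 / α - realZeta (α - 1)))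

/-- The local truncation error `T^n_j` of the explicit scheme: the residual left when the exact
solution, restricted to the grid, is inserted into the scheme. -/
def truncError (α : ℝ) (σ : ℝ → ℝ) (u : ℝ → ℝ → ℝ) (dt h : ℝ) (J : ℕ) (n : ℕ) (j : ℤ) : ℝ :=
  (u ((j : ℝ) * h) (((n : ℝ) + 1) * dt) - u ((j : ℝ) * h) ((n : ℝ) * dt)) / dt -
    discreteOp α σ h J (fun i : ℤ => u ((i : ℝ) * h) ((n : ℝ) * dt)) j

end NonlocalFPE

end

/-! Folding the principal value gives the absolutely convergent integral over `z > 0` of S(z)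
z^{-1-α}, with S(z) = u(x+z) + u(x-z) - 2u(x). Write S(z) = a z² + r(z), where a = u_xx(x) and r =
O(z⁴). The remainder is flat enough at 0 for the trapezoidal rule to be second order. For the pure
power z^{1-α}, the limiting trapezoidal error is exactly ζ(α-1) h^{2-α}, by Euler–Maclaurin
(`tendsto_realZeta`). Replacing a h² by S(h) costs O(h^{4-α}) and turns this error into the
correction term of the scheme (`modified_trapezoid_error_le`). Cutting the lattice sum at the
boundary costs O(L^{-α}) at points whose distance to the boundary is comparable to L
(`abs_primedSum_sub_le`, `mul_tail_le`). Together with the forward difference in time this bounds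
the truncation error.

Stability rests on ζ(α-1) < 0 (`realZeta_neg`): all off-diagonal weights of the scheme are then
nonnegative, and the CFL condition keeps the diagonal weight nonnegative. An Euler step is therefore
monotone (`euler_step_mono`), which gives a maximum principle and comparison.

The far-field condition replaces u by 0, so near and beyond the boundary the error is merely
bounded, by 2K. To keep it from spoiling the inner half, the error is compared with the barrier 2K
χ(x/L) + tA, where χ = `farCutoff` is 0 on the inner half and 1 for |x| ≥ 3L/4. Since χ is
semiconcave and the operator scales like L^{-α}, the discrete operator applied to χ(x/L) is at most
C L^{-α} for |x| ≤ 3L/4 (`exists_discreteOp_farCutoff_le`). Taking A of the order of the truncation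
error plus L^{-α} makes the barrier a supersolution there, and on the inner half only tA remains
(`error_le_barrier`). -/

noncomputable section

namespace NonlocalFPE

/-! ### The trapezoidal rule on one cell -/

/-- Error of the trapezoidal rule, for a function with bounded second derivative; `A` is an
antiderivative of `F`. -/
theorem trapezoid_error_le {E : Type*} [NormedAddCommGroup E] [NormedSpace ℝ E]
    {A F F' F'' : ℝ → E} {a b B : ℝ} (hab : a ≤ b)
    (hA : ∀ x ∈ Icc a b, HasDerivAt A (F x) x)
    (hF : ∀ x ∈ Icc a b, HasDerivAt F (F' x) x)
    (hF' : ∀ x ∈ Icc a b, HasDerivAt F' (F'' x) x)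
    (hB : ∀ x ∈ Icc a b, ‖F'' x‖ ≤ B) :
    ‖((b - a) / 2) • (F a + F b) - (A b - A a)‖ ≤ B / 8 * (b - a) ^ 3 := by
  -- Two integrations by parts in antiderivative form: Φ' is F'' times the Peano kernel
  -- (x-a)(b-x)/2. Bounding the kernel by its maximum (b-a)²/8 gives the constant 1/8; the sharp
  -- 1/12 is not needed.
  set Φ : ℝ → E := fun x =>
    ((x - a) * (b - x) / 2) • F' x - ((a + b) / 2 - x) • F x - A x with hΦ
  have hd : ∀ x ∈ Icc a b, HasDerivAt Φ (((x - a) * (b - x) / 2) • F'' x) x := by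
    intro x hx
    have h1 : HasDerivAt (fun x : ℝ => (x - a) * (b - x) / 2) ((a + b) / 2 - x) x := by
      have := ((((hasDerivAt_id x).sub_const a).mul ((hasDerivAt_id x).const_sub b)).div_const 2)
      refine this.congr_deriv ?_
      simp; ring
    have h2 : HasDerivAt (fun x : ℝ => (a + b) / 2 - x) (-1) x :=
      (hasDerivAt_id x).const_sub _
    have := ((h1.smul (hF' x hx)).sub (h2.smul (hF x hx))).sub (hA x hx)
    refine this.congr_deriv ?_
    module
  have hbd : ∀ x ∈ Ico a b, ‖((x - a) * (b - x) / 2) • F'' x‖ ≤ B / 8 * (b - a) ^ 2 := by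
    intro x hx
    have hx' := Ico_subset_Icc_self hx
    have h0 : 0 ≤ (x - a) * (b - x) / 2 := by
      have := mul_nonneg (sub_nonneg.2 hx'.1) (sub_nonneg.2 hx'.2)
      linarith
    rw [norm_smul, Real.norm_of_nonneg h0]
    have h1 : (x - a) * (b - x) / 2 ≤ (b - a) ^ 2 / 8 := by nlinarith [sq_nonneg (2 * x - a - b)]
    calc _ ≤ (b - a) ^ 2 / 8 * B := mul_le_mul h1 (hB x hx') (norm_nonneg _) (by positivity)
      _ = _ := by ring
  have := norm_image_sub_le_of_norm_deriv_le_segment'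
    (fun x hx => (hd x hx).hasDerivWithinAt) hbd b (right_mem_Icc.2 hab)
  have h3 : Φ b - Φ a = ((b - a) / 2) • (F a + F b) - (A b - A a) := by
    simp only [hΦ]
    module
  rw [h3] at this
  calc _ ≤ _ := this
    _ = _ := by ring

/-- The trapezoidal rule underestimates the integral of a concave function. -/
theorem trapezoid_le_of_concave
    {A F F' F'' : ℝ → ℝ} {a b : ℝ} (hab : a ≤ b)
    (hA : ∀ x ∈ Icc a b, HasDerivAt A (F x) x)
    (hF : ∀ x ∈ Icc a b, HasDerivAt F (F' x) x)
    (hF' : ∀ x ∈ Icc a b, HasDerivAt F' (F'' x) x)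
    (hB : ∀ x ∈ Icc a b, F'' x ≤ 0) :
    (b - a) / 2 * (F a + F b) ≤ A b - A a := by
  set Φ : ℝ → ℝ := fun x =>
    ((x - a) * (b - x) / 2) * F' x - ((a + b) / 2 - x) * F x - A x with hΦ
  have hd : ∀ x ∈ Icc a b, HasDerivAt Φ (((x - a) * (b - x) / 2) * F'' x) x := by
    intro x hx
    have h1 : HasDerivAt (fun x : ℝ => (x - a) * (b - x) / 2) ((a + b) / 2 - x) x := by
      have := ((((hasDerivAt_id x).sub_const a).mul ((hasDerivAt_id x).const_sub b)).div_const 2)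
      refine this.congr_deriv ?_
      simp; ring
    have h2 : HasDerivAt (fun x : ℝ => (a + b) / 2 - x) (-1) x :=
      (hasDerivAt_id x).const_sub _
    have := ((h1.mul (hF' x hx)).sub (h2.mul (hF x hx))).sub (hA x hx)
    refine this.congr_deriv ?_
    ring
  have hanti : AntitoneOn Φ (Icc a b) := by
    refine antitoneOn_of_deriv_nonpos (convex_Icc a b)
      (fun x hx => (hd x hx).continuousAt.continuousWithinAt)
      (fun x hx => (hd x (interior_subset hx)).differentiableAt.differentiableWithinAt) ?_
    intro x hx
    have hx' := interior_subset hx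
    rw [(hd x hx').deriv]
    exact mul_nonpos_of_nonneg_of_nonpos
      (div_nonneg (mul_nonneg (sub_nonneg.2 hx'.1) (sub_nonneg.2 hx'.2)) zero_le_two) (hB x hx')
  have := hanti (left_mem_Icc.2 hab) (right_mem_Icc.2 hab) hab
  simp only [hΦ] at this
  nlinarith

/-! ### Zeta as a limit of trapezoidal errors, and its sign on (-1, 1) -/

theorem hasDerivAt_ofReal_cpow {x : ℝ} (hx : 0 < x) (r : ℂ) :
    HasDerivAt (fun y : ℝ => (y : ℂ) ^ r) (r * (x : ℂ) ^ (r - 1)) x := by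
  have := (hasDerivAt_id (x : ℂ)).cpow_const (c := r) (Or.inl (by simpa using hx))
  simpa using this.comp_ofReal

/-- Trapezoidal errors of `z ↦ (s - 1) z^{-s}` on `[k + 1, k + 2]`. -/
def zetaTerm (k : ℕ) (s : ℂ) : ℂ :=
  (s - 1) * ((((k + 1 : ℝ) : ℂ) ^ (-s) + ((k + 2 : ℝ) : ℂ) ^ (-s)) / 2) +
    (((k + 2 : ℝ) : ℂ) ^ (1 - s) - ((k + 1 : ℝ) : ℂ) ^ (1 - s))

/-- The second derivative of (s-1) z^{-s} is (s-1)s(s+1) z^{-s-2}, and 5·4·5 = 100 bounds the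
polynomial factor. The resulting series converges uniformly as far left as Re s > -1 + δ. The factor
s - 1 clears the denominator of the antiderivative, so every term is entire in s. -/
theorem norm_zetaTerm_le (k : ℕ) {s : ℂ} {δ : ℝ} (hδ : -1 + δ < s.re) (hδ0 : 0 < δ)
    (hs : ‖s‖ < 4) :
    ‖zetaTerm k s‖ ≤ 100 * (1 / |(k : ℝ) + 1| ^ (1 + δ)) := by
  have hpos : ∀ x ∈ Icc (k + 1 : ℝ) (k + 2), 0 < x := fun x hx =>
    lt_of_lt_of_le (by positivity) hx.1
  have := trapezoid_error_le (a := (k + 1 : ℝ)) (b := k + 2)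
    (A := fun z : ℝ => -((z : ℂ) ^ (1 - s))) (F := fun z : ℝ => (s - 1) * (z : ℂ) ^ (-s))
    (F' := fun z : ℝ => (s - 1) * ((-s) * (z : ℂ) ^ (-s - 1)))
    (F'' := fun z : ℝ => (s - 1) * ((-s) * ((-s - 1) * (z : ℂ) ^ (-s - 1 - 1))))
    (B := 100 * (1 / |(k : ℝ) + 1| ^ (1 + δ))) (by linarith) ?_ ?_ ?_ ?_
  · have h2 : zetaTerm k s = (((k + 2 : ℝ) - (k + 1)) / 2) •
        ((s - 1) * ((k + 1 : ℝ) : ℂ) ^ (-s) + (s - 1) * ((k + 2 : ℝ) : ℂ) ^ (-s)) -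
        (-(((k + 2 : ℝ) : ℂ) ^ (1 - s)) - -(((k + 1 : ℝ) : ℂ) ^ (1 - s))) := by
      rw [zetaTerm, Complex.real_smul]
      push_cast
      ring
    rw [h2]
    refine this.trans ?_
    have h3 : (0 : ℝ) ≤ 1 / |(k : ℝ) + 1| ^ (1 + δ) := by positivity
    nlinarith
  · intro x hx
    refine (hasDerivAt_ofReal_cpow (hpos x hx) (1 - s)).neg.congr_deriv ?_
    rw [show 1 - s - 1 = -s by ring]
    ring
  · intro x hx
    exact (hasDerivAt_ofReal_cpow (hpos x hx) (-s)).const_mul _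
  · intro x hx
    exact ((hasDerivAt_ofReal_cpow (hpos x hx) (-s - 1)).const_mul _).const_mul _
  · intro x hx
    have hx0 := hpos x hx
    rw [norm_mul, norm_mul, norm_mul, norm_neg, Complex.norm_cpow_eq_rpow_re_of_pos hx0]
    have h1 : ‖s - 1‖ ≤ 5 := (norm_sub_le _ _).trans (by simp; linarith)
    have h2 : ‖-s - 1‖ ≤ 5 := (norm_sub_le _ _).trans (by simp; linarith)
    have h3 : x ^ (-s - 1 - 1).re ≤ 1 / |(k : ℝ) + 1| ^ (1 + δ) := by
      rw [abs_of_pos (by positivity), one_div, ← Real.rpow_neg (by positivity)]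
      have hk : (1 : ℝ) ≤ k + 1 := by linarith [(Nat.cast_nonneg k : (0 : ℝ) ≤ k)]
      calc x ^ (-s - 1 - 1).re ≤ x ^ (-(1 + δ)) := by
            apply Real.rpow_le_rpow_of_exponent_le (hk.trans hx.1)
            simp; linarith
        _ ≤ _ := Real.rpow_le_rpow_of_nonpos (by positivity) hx.1 (by linarith)
    calc ‖s - 1‖ * (‖s‖ * (‖-s - 1‖ * x ^ (-s - 1 - 1).re))
        ≤ 5 * (4 * (5 * (1 / |(k : ℝ) + 1| ^ (1 + δ)))) := by gcongr
      _ = _ := by ring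

theorem sum_zetaTerm (N : ℕ) (s : ℂ) :
    ∑ k ∈ Finset.range N, zetaTerm k s =
      (s - 1) * (∑ k ∈ Finset.range N, 1 / ((k : ℂ) + 1) ^ s - 1 / 2 +
        ((N + 1 : ℝ) : ℂ) ^ (-s) / 2) + (((N + 1 : ℝ) : ℂ) ^ (1 - s) - 1) := by
  induction N with
  | zero => simp
  | succ n ih =>
    rw [Finset.sum_range_succ, Finset.sum_range_succ, ih, zetaTerm]
    have : (1 : ℂ) / ((n : ℂ) + 1) ^ s = ((n + 1 : ℝ) : ℂ) ^ (-s) := by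
      rw [Complex.cpow_neg, one_div]; push_cast; rfl
    rw [this]
    have h2 : ((n + 1 : ℕ) + 1 : ℝ) = n + 2 := by push_cast; ring
    rw [h2]
    ring

theorem tendsto_natCast_cpow_zero {r : ℂ} (hr : r.re < 0) :
    Tendsto (fun N : ℕ => ((N + 1 : ℝ) : ℂ) ^ r) atTop (𝓝 0) := by
  rw [tendsto_zero_iff_norm_tendsto_zero]
  have h : ∀ N : ℕ, ‖((N + 1 : ℝ) : ℂ) ^ r‖ = ((N + 1 : ℝ)) ^ (-(-r.re)) := fun N => by
    rw [Complex.norm_cpow_eq_rpow_re_of_pos (by positivity), neg_neg]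
  simp_rw [h]
  exact (tendsto_rpow_neg_atTop (by linarith)).comp
    (tendsto_atTop_add_const_right _ _ tendsto_natCast_atTop_atTop)

/-- The errors telescope by `sum_zetaTerm`, and for Re s > 1 both boundary powers of N + 1 vanish in
the limit. -/
theorem tsum_zetaTerm_of_one_lt_re {s : ℂ} (hs : 1 < s.re)
    (hsum : Summable fun k => zetaTerm k s) :
    ∑' k, zetaTerm k s = (s - 1) * (riemannZeta s - 1 / 2) - 1 := by
  refine tendsto_nhds_unique hsum.hasSum.tendsto_sum_nat ?_
  simp_rw [sum_zetaTerm]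
  have h1 : Tendsto (fun N : ℕ => ∑ k ∈ Finset.range N, 1 / ((k : ℂ) + 1) ^ s) atTop
      (𝓝 (riemannZeta s)) := by
    rw [zeta_eq_tsum_one_div_nat_add_one_cpow hs]
    have : Summable fun n : ℕ => 1 / ((n : ℂ) + 1) ^ s := by
      have := (summable_nat_add_iff 1).2 (Complex.summable_one_div_nat_cpow.2 hs)
      simpa using this
    exact this.hasSum.tendsto_sum_nat
  have h2 := tendsto_natCast_cpow_zero (r := -s) (by simp; linarith)
  have h3 := tendsto_natCast_cpow_zero (r := 1 - s) (by simp; linarith)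
  have := ((((h1.sub_const (1 / 2)).add (h2.div_const 2)).const_mul (s - 1)).add
    (h3.sub_const 1))
  convert this using 2
  ring

/-- Euler–Maclaurin representation of `ζ` to the left of the line `Re s = 1`. -/
theorem hasSum_zetaTerm {s : ℂ} (hs : -1 < s.re) (hs4 : ‖s‖ < 4) (hs1 : s ≠ 1) :
    HasSum (fun k => zetaTerm k s) ((s - 1) * (riemannZeta s - 1 / 2) - 1) := by
  obtain ⟨δ, hδ0, hδ1, hδ⟩ : ∃ δ : ℝ, 0 < δ ∧ δ ≤ 1 ∧ -1 + δ < s.re :=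
    ⟨min 1 ((s.re + 1) / 2), lt_min one_pos (by linarith), min_le_left _ _, by
      have := min_le_right 1 ((s.re + 1) / 2); linarith⟩
  -- A convex domain containing both s and the point 3, near which the Dirichlet series is
  -- available; the radius 4 only serves the uniform bound.
  set U : Set ℂ := {s : ℂ | -1 + δ < s.re} ∩ Metric.ball 0 4 with hU
  have hUo : IsOpen U := (isOpen_lt continuous_const Complex.continuous_re).inter Metric.isOpen_ball
  have hUc : Convex ℝ U := (convex_halfSpace_re_gt _).inter (convex_ball _ _)
  have hbound : ∀ (k : ℕ) (w : ℂ), w ∈ U → ‖zetaTerm k w‖ ≤ 100 * (1 / |(k : ℝ) + 1| ^ (1 + δ)) :=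
    fun k w hw => norm_zetaTerm_le k hw.1 hδ0 (by simpa using hw.2)
  have hsummable : Summable fun k : ℕ => 100 * (1 / |(k : ℝ) + 1| ^ (1 + δ)) :=
    ((Real.summable_one_div_nat_add_rpow 1 (1 + δ)).2 (by linarith)).mul_left _
  have hsumm : ∀ w ∈ U, Summable fun k => zetaTerm k w := fun w hw =>
    Summable.of_norm_bounded hsummable fun k => hbound k w hw
  have hdiff : DifferentiableOn ℂ (fun w => ∑' k, zetaTerm k w) U := by
    refine Complex.differentiableOn_tsum_of_summable_norm hsummable (fun k => ?_) hUo hbound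
    have hk1 : ((k + 1 : ℝ) : ℂ) ≠ 0 := by exact_mod_cast (by positivity : (k + 1 : ℝ) ≠ 0)
    have hk2 : ((k + 2 : ℝ) : ℂ) ≠ 0 := by exact_mod_cast (by positivity : (k + 2 : ℝ) ≠ 0)
    have hcp : ∀ (c : ℂ), c ≠ 0 → ∀ f : ℂ → ℂ, Differentiable ℂ f →
        Differentiable ℂ fun w => c ^ f w := fun c hc f hf x =>
      (hf x).const_cpow (Or.inl hc)
    refine Differentiable.differentiableOn ?_
    unfold zetaTerm
    exact ((differentiable_id.sub_const 1).mul
      (((hcp _ hk1 _ differentiable_neg).add (hcp _ hk2 _ differentiable_neg)).div_const 2)).add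
      ((hcp _ hk2 _ (differentiable_id.const_sub 1)).sub
        (hcp _ hk1 _ (differentiable_id.const_sub 1)))
  -- The expected sum, written with the entire function (w-1)ζ(w) so that w = 1 is not exceptional
  -- for the identity theorem on U.
  set g : ℂ → ℂ := fun w => riemannZeta₁ w - (w - 1) / 2 - 1 with hg
  have hgd : Differentiable ℂ g := by
    refine Differentiable.sub_const (differentiable_riemannZeta₁.sub ?_) 1
    fun_prop
  have hgeq : ∀ w : ℂ, w ≠ 1 → g w = (w - 1) * (riemannZeta w - 1 / 2) - 1 := by
    intro w hw
    have : w - 1 ≠ 0 := sub_ne_zero.2 hw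
    rw [hg, riemannZeta_eq_inv_sub_mul hw]
    field_simp
  have h3 : (3 : ℂ) ∈ U := by
    refine ⟨?_, by simp; norm_num⟩
    simp; linarith
  have hev : (fun w => ∑' k, zetaTerm k w) =ᶠ[𝓝 3] g := by
    have h1 : ∀ᶠ w : ℂ in 𝓝 3, w ∈ U := hUo.mem_nhds h3
    have h2 : ∀ᶠ w : ℂ in 𝓝 3, 1 < w.re :=
      (isOpen_lt continuous_const Complex.continuous_re).mem_nhds
        (show (1 : ℝ) < (3 : ℂ).re by simp)
    filter_upwards [h1, h2] with w hw1 hw2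
    rw [tsum_zetaTerm_of_one_lt_re hw2 (hsumm w hw1), hgeq]
    rintro rfl
    simp at hw2
  have hsU : s ∈ U := ⟨hδ, by simpa using hs4⟩
  have := (hdiff.analyticOnNhd hUo).eqOn_of_preconnected_of_eventuallyEq
    (hgd.differentiableOn.analyticOnNhd hUo) hUc.isPreconnected h3 hev hsU
  rw [← hgeq s hs1, ← this]
  exact (hsumm s hsU).hasSum

/-- `ζ(s)` as the limit of trapezoidal errors of `z^{-s}`, for real `s ∈ (-1, 1)`. -/
theorem tendsto_realZeta {s : ℝ} (hs : -1 < s) (hs1 : s < 1) :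
    Tendsto (fun N : ℕ => ∑ k ∈ Finset.range N, (k + 1 : ℝ) ^ (-s) + (N + 1 : ℝ) ^ (-s) / 2 -
      (N + 1 : ℝ) ^ (1 - s) / (1 - s)) atTop (𝓝 (realZeta s)) := by
  have h := (hasSum_zetaTerm (s := (s : ℂ)) (by simpa using hs)
    (by rw [Complex.norm_real, Real.norm_eq_abs, abs_lt]; constructor <;> linarith)
    (by exact_mod_cast hs1.ne)).tendsto_sum_nat
  have h2 := (Complex.continuous_re.tendsto _).comp h
  have h3 : ∀ N : ℕ, (∑ k ∈ Finset.range N, zetaTerm k (s : ℂ)) =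
      (((s - 1) * (∑ k ∈ Finset.range N, (k + 1 : ℝ) ^ (-s) - 1 / 2 + (N + 1 : ℝ) ^ (-s) / 2) +
        ((N + 1 : ℝ) ^ (1 - s) - 1) : ℝ) : ℂ) := by
    intro N
    have hk : ∀ k : ℕ, (1 : ℂ) / ((k : ℂ) + 1) ^ (s : ℂ) = (((k + 1 : ℝ) ^ (-s) : ℝ) : ℂ) := by
      intro k
      rw [Complex.ofReal_cpow (by positivity)]
      push_cast
      rw [Complex.cpow_neg, one_div]
    rw [sum_zetaTerm, Finset.sum_congr rfl fun k _ => hk k]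
    push_cast
    rw [Complex.ofReal_cpow (by positivity), Complex.ofReal_cpow (by positivity)]
    push_cast
    rfl
  have h4 : (((s : ℂ) - 1) * (riemannZeta s - 1 / 2) - 1).re =
      (s - 1) * (realZeta s - 1 / 2) - 1 := by
    rw [show ((s : ℂ) - 1) = ((s - 1 : ℝ) : ℂ) by push_cast; rfl, Complex.sub_re,
      Complex.re_ofReal_mul, Complex.sub_re]
    norm_num [realZeta]
  have h5 : s - 1 ≠ 0 := by linarith
  have h6 : 1 - s ≠ 0 := by linarith
  have h7 : Tendsto (fun N : ℕ => (s - 1) * (∑ k ∈ Finset.range N, (k + 1 : ℝ) ^ (-s) - 1 / 2 +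
      (N + 1 : ℝ) ^ (-s) / 2) + ((N + 1 : ℝ) ^ (1 - s) - 1)) atTop
      (𝓝 ((s - 1) * (realZeta s - 1 / 2) - 1)) := by
    rw [← h4]
    refine h2.congr fun N => ?_
    simp only [Function.comp]
    rw [h3, Complex.ofReal_re]
  have h8 := ((h7.add_const 1).div_const (s - 1)).add_const (1 / 2)
  convert h8 using 2
  · rw [show (1 - s) = -(s - 1) by ring]
    field_simp
    ring
  · field_simp
    ring

theorem hasDerivAt_rpow_pos {x : ℝ} (hx : 0 < x) (r : ℝ) :
    HasDerivAt (fun y : ℝ => y ^ r) (r * x ^ (r - 1)) x :=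
  Real.hasDerivAt_rpow_const (Or.inl hx.ne')

/-- For s ≤ 0 the power z^{-s} is concave, so adding a cell never increases the trapezoidal error
and the limit is at most its N = 0 value 1/2 - 1/(1-s), negative because s > -1. For s > 0 the power
decreases, so sums with full weight at the right end are nonincreasing relative to the integral; the
limit is at most 1 - 1/(1-s) < 0. -/
theorem realZeta_neg {s : ℝ} (hs : -1 < s) (hs1 : s < 1) : realZeta s < 0 := by
  have hlim := tendsto_realZeta hs hs1
  have h1s : 0 < 1 - s := by linarith
  rcases le_or_gt s 0 with h0 | h0
  · have hbound : ∀ N : ℕ, ∑ k ∈ Finset.range N, (k + 1 : ℝ) ^ (-s) + (N + 1 : ℝ) ^ (-s) / 2 -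
        (N + 1 : ℝ) ^ (1 - s) / (1 - s) ≤ 1 / 2 - 1 / (1 - s) := by
      intro N
      induction N with
      | zero => simp
      | succ n ih =>
        have hpos : ∀ x ∈ Icc (n + 1 : ℝ) (n + 2), 0 < x := fun x hx =>
          lt_of_lt_of_le (by positivity) hx.1
        have := trapezoid_le_of_concave (a := (n + 1 : ℝ)) (b := n + 2)
          (A := fun z => z ^ (1 - s) / (1 - s)) (F := fun z => z ^ (-s))
          (F' := fun z => (-s) * z ^ (-s - 1))
          (F'' := fun z => (-s) * ((-s - 1) * z ^ (-s - 1 - 1))) (by linarith)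
          (fun x hx => by
            refine ((hasDerivAt_rpow_pos (hpos x hx) (1 - s)).div_const _).congr_deriv ?_
            rw [show 1 - s - 1 = -s by ring]
            field_simp)
          (fun x hx => hasDerivAt_rpow_pos (hpos x hx) _)
          (fun x hx => (hasDerivAt_rpow_pos (hpos x hx) _).const_mul _)
          (fun x hx => by
            have := Real.rpow_nonneg (hpos x hx).le (-s - 1 - 1)
            have h2 : (-s - 1) * x ^ (-s - 1 - 1) ≤ 0 :=
              mul_nonpos_of_nonpos_of_nonneg (by linarith) this
            exact mul_nonpos_of_nonneg_of_nonpos (by linarith) h2)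
        rw [Finset.sum_range_succ]
        have h2 : ((n + 1 : ℕ) + 1 : ℝ) = n + 2 := by push_cast; ring
        rw [h2]
        linarith
    have := le_of_tendsto' hlim hbound
    have h3 : (1 : ℝ) / 2 < 1 / (1 - s) := by
      rw [div_lt_div_iff₀ two_pos h1s]; linarith
    linarith
  · have hbound : ∀ N : ℕ, ∑ k ∈ Finset.range N, (k + 1 : ℝ) ^ (-s) + (N + 1 : ℝ) ^ (-s) -
        (N + 1 : ℝ) ^ (1 - s) / (1 - s) ≤ 1 - 1 / (1 - s) := by
      intro N
      induction N with
      | zero => simp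
      | succ n ih =>
        rw [Finset.sum_range_succ]
        have h2 : ((n + 1 : ℕ) + 1 : ℝ) = n + 2 := by push_cast; ring
        rw [h2]
        have hpos : ∀ x ∈ Icc (n + 1 : ℝ) (n + 2), 0 < x := fun x hx =>
          lt_of_lt_of_le (by positivity) hx.1
        have hmono : MonotoneOn (fun z : ℝ => z ^ (1 - s) / (1 - s) - (n + 2 : ℝ) ^ (-s) * z)
            (Icc (n + 1 : ℝ) (n + 2)) := by
          have hd : ∀ x ∈ Icc (n + 1 : ℝ) (n + 2), HasDerivAt
              (fun z : ℝ => z ^ (1 - s) / (1 - s) - (n + 2 : ℝ) ^ (-s) * z)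
              (x ^ (-s) - (n + 2 : ℝ) ^ (-s)) x := fun x hx => by
            refine (((hasDerivAt_rpow_pos (hpos x hx) (1 - s)).div_const _).sub
              ((hasDerivAt_id x).const_mul _)).congr_deriv ?_
            rw [show 1 - s - 1 = -s by ring]
            field_simp
          refine monotoneOn_of_deriv_nonneg (convex_Icc _ _)
            (fun x hx => (hd x hx).continuousAt.continuousWithinAt)
            (fun x hx => (hd x (interior_subset hx)).differentiableAt.differentiableWithinAt) ?_
          intro x hx
          have hx' := interior_subset hx
          rw [(hd x hx').deriv, sub_nonneg]
          exact Real.rpow_le_rpow_of_nonpos (hpos x hx') hx'.2 (by linarith)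
        have := hmono (left_mem_Icc.2 (by linarith)) (right_mem_Icc.2 (by linarith)) (by linarith)
        simp only at this
        nlinarith
    have hb2 := le_of_tendsto' hlim (fun N => (show _ ≤ 1 - 1 / (1 - s) by
      have := hbound N
      have h3 : (0 : ℝ) ≤ (N + 1 : ℝ) ^ (-s) := by positivity
      linarith))
    have h3 : (1 : ℝ) < 1 / (1 - s) := by
      rw [lt_div_iff₀ h1s]; linarith
    linarith

/-! ### Lattice sums of powers and of the Lévy weight -/

theorem rpow_neg_one_add_le_sub {α x : ℝ} (hα : 0 < α) (hx : 0 < x) :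
    (x + 1) ^ (-(1 + α)) ≤ (x ^ (-α) - (x + 1) ^ (-α)) / α := by
  have hd : ∀ y ∈ Icc x (x + 1), HasDerivAt (fun z : ℝ => z ^ (-α) + α * (x + 1) ^ (-(1 + α)) * z)
      (-α * y ^ (-α - 1) + α * (x + 1) ^ (-(1 + α))) y := fun y hy => by
    have := (hasDerivAt_rpow_pos (hx.trans_le hy.1) (-α)).add
      ((hasDerivAt_id y).const_mul (α * (x + 1) ^ (-(1 + α))))
    exact this.congr_deriv (by simp)
  have hanti : AntitoneOn (fun z : ℝ => z ^ (-α) + α * (x + 1) ^ (-(1 + α)) * z)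
      (Icc x (x + 1)) := by
    refine antitoneOn_of_deriv_nonpos (convex_Icc _ _)
      (fun y hy => (hd y hy).continuousAt.continuousWithinAt)
      (fun y hy => (hd y (interior_subset hy)).differentiableAt.differentiableWithinAt) ?_
    intro y hy
    have hy' := interior_subset hy
    rw [(hd y hy').deriv]
    have : (x + 1) ^ (-(1 + α)) ≤ y ^ (-(1 + α)) :=
      Real.rpow_le_rpow_of_nonpos (hx.trans_le hy'.1) hy'.2 (by linarith)
    rw [show -α - 1 = -(1 + α) by ring]
    nlinarith
  have := hanti (left_mem_Icc.2 (by linarith)) (right_mem_Icc.2 (by linarith))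
    (by linarith : x ≤ x + 1)
  simp only at this
  rw [le_div_iff₀ hα]
  nlinarith

/-- Integral comparison for all terms but the first, which is absorbed into x^{-α} because x ≥ 1. At
x = 1 this is the constant 1 + 1/α of the CFL condition. -/
theorem sum_rpow_tail_le {α x : ℝ} (hα : 0 < α) (hx : 1 ≤ x) (N : ℕ) :
    ∑ k ∈ Finset.range N, (x + k) ^ (-(1 + α)) ≤ (1 + 1 / α) * x ^ (-α) := by
  have hx0 : 0 < x := by linarith
  have h1 : ∀ N : ℕ, ∑ k ∈ Finset.range N, (x + (k + 1 : ℕ)) ^ (-(1 + α)) ≤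
      (x ^ (-α) - (x + N) ^ (-α)) / α := by
    intro N
    induction N with
    | zero => simp
    | succ n ih =>
      rw [Finset.sum_range_succ]
      have h2 := rpow_neg_one_add_le_sub hα (show 0 < x + n by positivity)
      have h3 : x + ((n + 1 : ℕ) : ℝ) = x + n + 1 := by push_cast; ring
      rw [h3]
      calc _ ≤ (x ^ (-α) - (x + n) ^ (-α)) / α +
            ((x + n) ^ (-α) - (x + n + 1) ^ (-α)) / α := add_le_add ih h2
        _ = _ := by ring
  have h4 : x ^ (-(1 + α)) ≤ x ^ (-α) := Real.rpow_le_rpow_of_exponent_le hx (by linarith)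
  have h5 : (x ^ (-α) - (x + N) ^ (-α)) / α ≤ 1 / α * x ^ (-α) := by
    have : 0 ≤ (x + N : ℝ) ^ (-α) := by positivity
    rw [div_mul_eq_mul_div, one_mul]
    gcongr
    linarith
  calc ∑ k ∈ Finset.range N, (x + k) ^ (-(1 + α))
      ≤ ∑ k ∈ Finset.range (N + 1), (x + k) ^ (-(1 + α)) := by
        rw [Finset.sum_range_succ]
        have : 0 ≤ (x + N : ℝ) ^ (-(1 + α)) := by positivity
        linarith
    _ = ∑ k ∈ Finset.range N, (x + (k + 1 : ℕ)) ^ (-(1 + α)) + x ^ (-(1 + α)) := by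
        rw [Finset.sum_range_succ']; simp
    _ ≤ _ := by linarith [h1 N]

/-- The model integrand `min(1, z²) z^{-1-α}`. -/
def levyWeight (α z : ℝ) : ℝ := min 1 (z ^ 2) * z ^ (-(1 + α))

theorem levyWeight_nonneg {α z : ℝ} (hz : 0 ≤ z) : 0 ≤ levyWeight α z :=
  mul_nonneg (le_min zero_le_one (sq_nonneg z)) (Real.rpow_nonneg hz _)

/-- The weight is not monotone for α < 1: it rises like z^{1-α} up to 1 and then decays.
Comparability within a factor two of the argument, in both directions, takes the place of
monotonicity. -/
theorem levyWeight_le_four_mul {α y z : ℝ} (hα : 0 < α) (hy : 0 < y) (hyz : y ≤ z)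
    (hz : z ≤ 2 * y) : levyWeight α z ≤ 4 * levyWeight α y := by
  have h1 : z ^ (-(1 + α)) ≤ y ^ (-(1 + α)) := Real.rpow_le_rpow_of_nonpos hy hyz (by linarith)
  have h2 : min 1 (z ^ 2) ≤ 4 * min 1 (y ^ 2) := by
    rcases le_total 1 (y ^ 2) with h | h
    · rw [min_eq_left h]; exact (min_le_left _ _).trans (by norm_num)
    · rw [min_eq_right h]; exact (min_le_right _ _).trans (by nlinarith)
  have h3 : 0 ≤ min 1 (y ^ 2) := le_min zero_le_one (sq_nonneg y)
  calc levyWeight α z ≤ 4 * min 1 (y ^ 2) * y ^ (-(1 + α)) :=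
        mul_le_mul h2 h1 (Real.rpow_nonneg (hy.le.trans hyz) _) (by positivity)
    _ = _ := by rw [levyWeight]; ring

theorem levyWeight_le_eight_mul {α y z : ℝ} (hα : 0 < α) (hα2 : α < 2) (hy : 0 < y) (hyz : y ≤ z)
    (hz : z ≤ 2 * y) : levyWeight α y ≤ 8 * levyWeight α z := by
  have h1 : y ^ (-(1 + α)) ≤ 8 * z ^ (-(1 + α)) := by
    have h2 : (2 * y) ^ (-(1 + α)) ≤ z ^ (-(1 + α)) :=
      Real.rpow_le_rpow_of_nonpos (hy.trans_le hyz) hz (by linarith)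
    rw [Real.mul_rpow two_pos.le hy.le] at h2
    have h3 : (2 : ℝ) ^ (-3 : ℝ) ≤ 2 ^ (-(1 + α)) :=
      Real.rpow_le_rpow_of_exponent_le one_le_two (by linarith)
    have h4 : (2 : ℝ) ^ (-3 : ℝ) = 1 / 8 := by
      rw [Real.rpow_neg two_pos.le]; norm_num
    rw [h4] at h3
    have h5 := Real.rpow_nonneg hy.le (-(1 + α))
    nlinarith
  have h2 : min 1 (y ^ 2) ≤ min 1 (z ^ 2) := min_le_min le_rfl (by gcongr)
  calc levyWeight α y ≤ min 1 (z ^ 2) * (8 * z ^ (-(1 + α))) :=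
        mul_le_mul h2 h1 (Real.rpow_nonneg hy.le _) (le_min zero_le_one (sq_nonneg z))
    _ = _ := by rw [levyWeight]; ring

theorem continuousOn_levyWeight (α : ℝ) : ContinuousOn (levyWeight α) (Ioi 0) := by
  refine ContinuousOn.mul (by fun_prop) ?_
  exact fun x hx => (Real.continuousAt_rpow_const _ _ (Or.inl (ne_of_gt hx))).continuousWithinAt

theorem sq_mul_rpow {α z : ℝ} (hz : 0 < z) : z ^ 2 * z ^ (-(1 + α)) = z ^ (1 - α) := by
  rw [← Real.rpow_natCast, ← Real.rpow_add hz]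
  congr 1
  push_cast
  ring

theorem integrableOn_levyWeight {α : ℝ} (hα : 0 < α) (hα2 : α < 2) :
    IntegrableOn (levyWeight α) (Ioi 0) := by
  have hmeas : ∀ s ⊆ Ioi (0 : ℝ), MeasurableSet s →
      AEStronglyMeasurable (levyWeight α) (volume.restrict s) := fun s hs hm =>
    ((continuousOn_levyWeight α).mono hs).aestronglyMeasurable hm
  rw [← Ioc_union_Ioi_eq_Ioi zero_le_one]
  refine IntegrableOn.union ?_ ?_
  · have h1 : IntegrableOn (fun z : ℝ => z ^ (1 - α)) (Ioc 0 1) := by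
      rw [← intervalIntegrable_iff_integrableOn_Ioc_of_le zero_le_one]
      exact intervalIntegral.intervalIntegrable_rpow' (by linarith)
    refine Integrable.mono' h1 (hmeas _ Ioc_subset_Ioi_self measurableSet_Ioc) ?_
    filter_upwards [ae_restrict_mem measurableSet_Ioc] with z hz
    rw [Real.norm_of_nonneg (levyWeight_nonneg hz.1.le), ← sq_mul_rpow hz.1]
    exact mul_le_mul_of_nonneg_right (min_le_right _ _) (Real.rpow_nonneg hz.1.le _)
  · have h1 : IntegrableOn (fun z : ℝ => z ^ (-(1 + α))) (Ioi 1) :=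
      integrableOn_Ioi_rpow_of_lt (by linarith) one_pos
    refine Integrable.mono' h1 (hmeas _ (Ioi_subset_Ioi zero_le_one) measurableSet_Ioi) ?_
    filter_upwards [ae_restrict_mem measurableSet_Ioi] with z hz
    have hz0 : (0 : ℝ) < z := one_pos.trans hz
    rw [Real.norm_of_nonneg (levyWeight_nonneg hz0.le)]
    calc levyWeight α z ≤ 1 * z ^ (-(1 + α)) :=
          mul_le_mul_of_nonneg_right (min_le_left _ _) (Real.rpow_nonneg hz0.le _)
      _ = _ := one_mul _

/-- Total mass of `levyWeight`. -/
def levyMass (α : ℝ) : ℝ := ∫ z in Ioi 0, levyWeight α z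

theorem levyMass_nonneg (α : ℝ) : 0 ≤ levyMass α :=
  setIntegral_nonneg measurableSet_Ioi fun _ hz => levyWeight_nonneg (le_of_lt hz)

/-- Each node is compared with the integral over the cell to its right, which stays within a factor
two of the node. The bound is thus uniform in both h and N, and the singularity at 0 is never
approached from the left of the first node. -/
theorem sum_levyWeight_le {α h : ℝ} (hα : 0 < α) (hα2 : α < 2) (hh : 0 < h) (N : ℕ) :
    ∑ k ∈ Finset.range N, h * levyWeight α ((k + 1) * h) ≤ 8 * levyMass α := by
  have hint := integrableOn_levyWeight hα hα2
  have hii : ∀ a b : ℝ, 0 < a → a ≤ b → IntervalIntegrable (levyWeight α) volume a b :=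
    fun a b ha hab => by
      rw [intervalIntegrable_iff_integrableOn_Ioc_of_le hab]
      exact hint.mono_set fun z hz => ha.trans hz.1
  have h1 : ∀ k : ℕ, h * levyWeight α ((k + 1) * h) ≤
      8 * ∫ z in ((k : ℝ) + 1) * h..((k + 1 : ℕ) + 1) * h, levyWeight α z := by
    intro k
    have hk : 0 < ((k : ℝ) + 1) * h := by positivity
    have hk2 : ((k : ℝ) + 1) * h ≤ ((k + 1 : ℕ) + 1) * h := by push_cast; nlinarith
    rw [← intervalIntegral.integral_const_mul]
    have h2 : h * levyWeight α ((k + 1) * h) =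
        ∫ _z in ((k : ℝ) + 1) * h..((k + 1 : ℕ) + 1) * h, levyWeight α ((k + 1) * h) := by
      rw [intervalIntegral.integral_const, smul_eq_mul]; push_cast; ring
    rw [h2]
    refine intervalIntegral.integral_mono_on hk2 (by simp) ((hii _ _ hk hk2).const_mul _) ?_
    intro z hz
    refine levyWeight_le_eight_mul hα hα2 hk hz.1 (hz.2.trans ?_)
    have : 0 ≤ (k : ℝ) * h := by positivity
    push_cast
    nlinarith
  have h3 : ∑ k ∈ Finset.range N, ∫ z in ((k : ℝ) + 1) * h..((k + 1 : ℕ) + 1) * h, levyWeight α z =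
      ∫ z in ((0 : ℕ) + 1 : ℝ) * h..((N : ℝ) + 1) * h, levyWeight α z := by
    refine intervalIntegral.sum_integral_adjacent_intervals (a := fun k : ℕ => ((k : ℝ) + 1) * h)
      fun k _ => hii _ _ (by positivity) ?_
    push_cast; nlinarith
  calc _ ≤ ∑ k ∈ Finset.range N,
        8 * ∫ z in ((k : ℝ) + 1) * h..((k + 1 : ℕ) + 1) * h, levyWeight α z :=
        Finset.sum_le_sum fun k _ => h1 k
    _ = 8 * ∫ z in ((0 : ℕ) + 1 : ℝ) * h..((N : ℝ) + 1) * h, levyWeight α z := by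
        rw [← Finset.mul_sum, h3]
    _ ≤ 8 * levyMass α := by
        have h5 : ((0 : ℕ) + 1 : ℝ) * h ≤ ((N : ℝ) + 1) * h := by gcongr; simp
        rw [intervalIntegral.integral_of_le h5]
        refine mul_le_mul_of_nonneg_left ?_ (by norm_num)
        refine setIntegral_mono_set hint ?_ ?_
        · filter_upwards [ae_restrict_mem measurableSet_Ioi] with z hz
          exact levyWeight_nonneg (le_of_lt hz)
        · exact Eventually.of_forall fun z hz => lt_trans (by simpa using hh) hz.1

/-! ### The trapezoidal rule with a singular weight -/

theorem hasDerivAt_integral_of_continuousOn_Ioi {q : ℝ → ℝ} (hq : ContinuousOn q (Ioi 0))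
    {a x : ℝ} (ha : 0 < a) (hx : 0 < x) : HasDerivAt (fun y => ∫ t in a..y, q t) (q x) x := by
  have hsub : uIcc a x ⊆ Ioi 0 := fun z hz => lt_of_lt_of_le (lt_min ha hx) hz.1
  exact intervalIntegral.integral_hasDerivAt_right ((hq.mono hsub).intervalIntegrable)
    (hq.stronglyMeasurableAtFilter isOpen_Ioi x hx) (hq.continuousAt (Ioi_mem_nhds hx))

/-- Trapezoidal rule for `r(z) z^{-1-α}` on `[0, (N + 1) h]`, where `r = O(z⁴)` at `0`. -/
theorem trapezoid_weighted_error_le {α M h : ℝ} {r r' r'' : ℝ → ℝ} (hα : 0 < α) (hα2 : α < 2)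
    (hh : 0 < h) (hh1 : h ≤ 1)
    (hr : ∀ z, 0 < z → HasDerivAt r (r' z) z) (hr' : ∀ z, 0 < z → HasDerivAt r' (r'' z) z)
    (hb : ∀ z, 0 < z → |r z| ≤ M * min 1 (z ^ 2) * z ^ 2)
    (hb' : ∀ z, 0 < z → |r' z| ≤ M * min 1 (z ^ 2) * z)
    (hb'' : ∀ z, 0 < z → |r'' z| ≤ M * min 1 (z ^ 2)) (N : ℕ)
    (hint : ∀ b, 0 ≤ b → IntervalIntegrable (fun z => r z * z ^ (-(1 + α))) volume 0 b) :
    |h * ∑ k ∈ Finset.range N, r ((k + 1) * h) * ((k + 1) * h) ^ (-(1 + α)) +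
        h / 2 * (r ((N + 1) * h) * ((N + 1) * h) ^ (-(1 + α))) -
        ∫ z in 0..((N + 1) * h), r z * z ^ (-(1 + α))| ≤
      2 * M * h ^ 2 + 10 * M * h ^ 2 * ∑ k ∈ Finset.range N, h * levyWeight α ((k + 1) * h) := by
  have hM : 0 ≤ M := by
    have := (abs_nonneg _).trans (hb'' 1 one_pos)
    simpa using this
  set q : ℝ → ℝ := fun z => r z * z ^ (-(1 + α)) with hq
  set q' : ℝ → ℝ := fun z => r' z * z ^ (-(1 + α)) + r z * (-(1 + α) * z ^ (-(1 + α) - 1)) with hq'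
  set q'' : ℝ → ℝ := fun z => (r'' z * z ^ (-(1 + α)) + r' z * (-(1 + α) * z ^ (-(1 + α) - 1))) +
    (r' z * (-(1 + α) * z ^ (-(1 + α) - 1)) +
      r z * (-(1 + α) * ((-(1 + α) - 1) * z ^ (-(1 + α) - 1 - 1)))) with hq''
  have hqd : ∀ z, 0 < z → HasDerivAt q (q' z) z := fun z hz =>
    (hr z hz).mul (hasDerivAt_rpow_pos hz _)
  have hqd' : ∀ z, 0 < z → HasDerivAt q' (q'' z) z := fun z hz =>
    ((hr' z hz).mul (hasDerivAt_rpow_pos hz _)).add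
      ((hr z hz).mul ((hasDerivAt_rpow_pos hz _).const_mul _))
  have hqc : ContinuousOn q (Ioi 0) := fun z hz => (hqd z hz).continuousAt.continuousWithinAt
  -- Each derivative falling on the power costs a factor 1/z, which the bounds on r and r'
  -- compensate. Since α < 2, the coefficients are at most 1, 6 and 12, hence 19.
  have hqb : ∀ z, 0 < z → |q'' z| ≤ 19 * M * levyWeight α z := by
    intro z hz
    have e1 : z ^ (-(1 + α) - 1) = z ^ (-(1 + α)) / z := Real.rpow_sub_one hz.ne' _
    have e2 : z ^ (-(1 + α) - 1 - 1) = z ^ (-(1 + α)) / z / z := by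
      rw [Real.rpow_sub_one hz.ne', e1]
    have e3 : q'' z = (r'' z - 2 * (1 + α) * (r' z / z) +
        (1 + α) * (2 + α) * (r z / z ^ 2)) * z ^ (-(1 + α)) := by
      simp only [hq'', e1, e2]
      field_simp
      ring
    have h1 : |r' z / z| ≤ M * min 1 (z ^ 2) := by
      rw [abs_div, abs_of_pos hz, div_le_iff₀ hz]; exact hb' z hz
    have h2 : |r z / z ^ 2| ≤ M * min 1 (z ^ 2) := by
      rw [abs_div, abs_of_pos (pow_pos hz 2), div_le_iff₀ (pow_pos hz 2)]; exact hb z hz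
    have h0 : 0 ≤ M * min 1 (z ^ 2) := (abs_nonneg _).trans h1
    have hz' := Real.rpow_nonneg hz.le (-(1 + α))
    rw [e3, abs_mul, abs_of_nonneg hz', levyWeight, ← mul_assoc]
    refine mul_le_mul_of_nonneg_right ?_ hz'
    calc _ ≤ |r'' z| + |2 * (1 + α) * (r' z / z)| + |(1 + α) * (2 + α) * (r z / z ^ 2)| :=
          (abs_add_le _ _).trans (add_le_add_left (abs_sub _ _) _)
      _ = |r'' z| + 2 * (1 + α) * |r' z / z| + (1 + α) * (2 + α) * |r z / z ^ 2| := by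
          rw [abs_mul, abs_mul ((1 + α) * (2 + α)), abs_of_pos (show 0 < 2 * (1 + α) by linarith),
            abs_of_pos (show 0 < (1 + α) * (2 + α) by positivity)]
      _ ≤ M * min 1 (z ^ 2) + 6 * (M * min 1 (z ^ 2)) + 12 * (M * min 1 (z ^ 2)) := by
          refine add_le_add (add_le_add (hb'' z hz) ?_) ?_
          · exact mul_le_mul (by linarith) h1 (abs_nonneg _) (by norm_num)
          · exact mul_le_mul (by nlinarith) h2 (abs_nonneg _) (by norm_num)
      _ = _ := by ring
  have hii : ∀ a b : ℝ, 0 ≤ a → 0 ≤ b → IntervalIntegrable q volume a b := fun a b ha hb =>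
    (hint a ha).symm.trans (hint b hb)
  induction N with
  | zero =>
    -- On the first cell no second-derivative bound up to 0 is used and the node 0 is dropped. The
    -- bound |q| ≤ M h there makes both the integral and the half-weighted node at h of size M h².
    have hq0 : ∀ z, 0 < z → z ≤ h → |q z| ≤ M * h := by
      intro z hz hzh
      have hz' := Real.rpow_nonneg hz.le (-(1 + α))
      rw [hq, abs_mul, abs_of_nonneg hz']
      calc |r z| * z ^ (-(1 + α)) ≤ M * min 1 (z ^ 2) * z ^ 2 * z ^ (-(1 + α)) :=
            mul_le_mul_of_nonneg_right (hb z hz) hz'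
        _ = M * (min 1 (z ^ 2) * z ^ (1 - α)) := by rw [← sq_mul_rpow hz]; ring
        _ ≤ M * (z ^ 2 * z ^ (1 - α)) := by
            refine mul_le_mul_of_nonneg_left ?_ hM
            exact mul_le_mul_of_nonneg_right (min_le_right _ _) (Real.rpow_nonneg hz.le _)
        _ = M * (z * z ^ (2 - α)) := by
            rw [show (2 : ℝ) - α = 1 + (1 - α) by ring, Real.rpow_add hz, Real.rpow_one]; ring
        _ ≤ M * (h * 1) := by
            refine mul_le_mul_of_nonneg_left ?_ hM
            exact mul_le_mul hzh (Real.rpow_le_one hz.le (hzh.trans hh1) (by linarith))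
              (Real.rpow_nonneg hz.le _) hh.le
        _ = _ := by ring
    have h1 : |∫ z in 0..h, q z| ≤ M * h * |h - 0| := by
      refine intervalIntegral.norm_integral_le_of_norm_le_const (f := q) fun z hz => ?_
      rw [uIoc_of_le hh.le] at hz
      exact hq0 z hz.1 hz.2
    rw [sub_zero, abs_of_pos hh] at h1
    have h2 : |h / 2 * q h| ≤ h / 2 * (M * h) := by
      rw [abs_mul, abs_of_pos (by positivity)]
      exact mul_le_mul_of_nonneg_left (hq0 h hh le_rfl) (by positivity)
    simp only [Finset.range_zero, Finset.sum_empty, mul_zero, Nat.cast_zero, zero_add, one_mul,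
      add_zero]
    refine (abs_sub _ _).trans ?_
    have : |h / 2 * (r h * h ^ (-(1 + α)))| = |h / 2 * q h| := rfl
    rw [this]
    nlinarith [mul_nonneg hM (sq_nonneg h)]
  | succ n ih =>
    have ha : 0 < ((n : ℝ) + 1) * h := by positivity
    have hn2 : (((n + 1 : ℕ) : ℝ) + 1) * h = (n + 1) * h + h := by push_cast; ring
    have hab : ((n : ℝ) + 1) * h ≤ (n + 1) * h + h := by linarith
    -- Later cells lie within a factor two of their left end, so `levyWeight` grows at most
    -- fourfold; 19·4/8 is then rounded up to 10.
    have h1 := trapezoid_error_le (a := ((n : ℝ) + 1) * h) (b := (n + 1) * h + h)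
      (A := fun y => ∫ t in ((n : ℝ) + 1) * h..y, q t) (F := q) (F' := q') (F'' := q'')
      (B := 19 * M * (4 * levyWeight α ((n + 1) * h))) hab
      (fun x hx => hasDerivAt_integral_of_continuousOn_Ioi hqc ha (ha.trans_le hx.1))
      (fun x hx => hqd x (ha.trans_le hx.1)) (fun x hx => hqd' x (ha.trans_le hx.1))
      (fun x hx => (hqb x (ha.trans_le hx.1)).trans (by
        refine mul_le_mul_of_nonneg_left ?_ (by positivity)
        refine levyWeight_le_four_mul hα ha hx.1 (hx.2.trans ?_)
        have : 0 ≤ (n : ℝ) * h := by positivity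
        linarith))
    rw [intervalIntegral.integral_same, sub_zero, add_sub_cancel_left, Real.norm_eq_abs,
      smul_eq_mul] at h1
    have h2 : (∫ z in 0..((n : ℝ) + 1) * h + h, q z) =
        (∫ z in 0..((n : ℝ) + 1) * h, q z) + ∫ z in ((n : ℝ) + 1) * h..((n + 1) * h + h), q z :=
      (intervalIntegral.integral_add_adjacent_intervals (hii _ _ le_rfl ha.le)
        (hii _ _ ha.le (by positivity))).symm
    rw [Finset.sum_range_succ, Finset.sum_range_succ, hn2]
    have h3 := abs_add_le
      (h * ∑ k ∈ Finset.range n, r ((k + 1) * h) * ((k + 1) * h) ^ (-(1 + α)) +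
        h / 2 * q ((n + 1) * h) - ∫ z in 0..((n + 1) * h), q z)
      (h / 2 * (q ((n + 1) * h) + q ((n + 1) * h + h)) -
        ∫ z in ((n : ℝ) + 1) * h..((n + 1) * h + h), q z)
    have hw : 0 ≤ M * h ^ 2 * (h * levyWeight α ((n + 1) * h)) :=
      mul_nonneg (by positivity) (mul_nonneg hh.le (levyWeight_nonneg ha.le))
    have h4 : 19 * M * (4 * levyWeight α ((n + 1) * h)) / 8 * h ^ 3 ≤
        10 * M * h ^ 2 * (h * levyWeight α ((n + 1) * h)) := by nlinarith
    calc _ = |(h * ∑ k ∈ Finset.range n, r ((k + 1) * h) * ((k + 1) * h) ^ (-(1 + α)) +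
        h / 2 * q ((n + 1) * h) - ∫ z in 0..((n + 1) * h), q z) +
      (h / 2 * (q ((n + 1) * h) + q ((n + 1) * h + h)) -
        ∫ z in ((n : ℝ) + 1) * h..((n + 1) * h + h), q z)| := by
          congr 1
          rw [h2]
          simp only [hq]
          ring
      _ ≤ _ := h3
      _ ≤ _ := add_le_add ih (h1.trans h4)
      _ = _ := by ring

/-! ### Second differences and the modified trapezoidal rule -/

/-- The symmetric second difference `f(x + z) + f(x - z) - 2 f(x)`. -/
def secondDiff (f : ℝ → ℝ) (x z : ℝ) : ℝ := f (x + z) + f (x - z) - 2 * f x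

theorem abs_le_mul_of_deriv {f f' : ℝ → ℝ} {B z : ℝ} (hz : 0 ≤ z) (h0 : f 0 = 0)
    (hf : ∀ t, HasDerivAt f (f' t) t) (hB : ∀ t, 0 ≤ t → t ≤ z → |f' t| ≤ B) :
    |f z| ≤ B * z := by
  have := norm_image_sub_le_of_norm_deriv_le_segment' (f := f) (f' := f') (a := 0) (b := z)
    (fun t _ => (hf t).hasDerivWithinAt) (fun t ht => hB t ht.1 ht.2.le) z (right_mem_Icc.2 hz)
  simpa [h0] using this

theorem hasDerivAt_comp_add {f f' : ℝ → ℝ} (hf : ∀ t, HasDerivAt f (f' t) t) (x t : ℝ) :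
    HasDerivAt (fun z => f (x + z)) (f' (x + t)) t := by
  simpa using (hf (x + t)).comp_const_add x t

theorem hasDerivAt_comp_sub {f f' : ℝ → ℝ} (hf : ∀ t, HasDerivAt f (f' t) t) (x t : ℝ) :
    HasDerivAt (fun z => f (x - z)) (-f' (x - t)) t := by
  simpa using (hf (x - t)).comp_const_sub x t

theorem hasDerivAt_secondDiff {f f' : ℝ → ℝ} (hf : ∀ t, HasDerivAt f (f' t) t) (x t : ℝ) :
    HasDerivAt (secondDiff f x) (f' (x + t) - f' (x - t)) t :=
  (((hasDerivAt_comp_add hf x t).add (hasDerivAt_comp_sub hf x t)).sub_const _)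

theorem abs_secondDiff_le_four_mul {f : ℝ → ℝ} {K : ℝ} (hK : ∀ y, |f y| ≤ K) (x z : ℝ) :
    |secondDiff f x z| ≤ 4 * K := by
  have h1 := abs_le.1 (hK (x + z))
  have h2 := abs_le.1 (hK (x - z))
  have h3 := abs_le.1 (hK x)
  rw [secondDiff, abs_le]
  constructor <;> linarith

/-- The first derivative enters only through f'(x+t) - f'(x-t), so bounds on f and f'' suffice. The
lemma is used for f itself and, with f'' in place of f, for the remainder. -/
theorem abs_secondDiff_le {f f' f'' : ℝ → ℝ} {K : ℝ} (hf : ∀ t, HasDerivAt f (f' t) t)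
    (hf' : ∀ t, HasDerivAt f' (f'' t) t) (hK : ∀ y, |f y| ≤ K) (hK'' : ∀ y, |f'' y| ≤ K)
    (x : ℝ) {z : ℝ} (hz : 0 ≤ z) : |secondDiff f x z| ≤ 4 * K * min 1 (z ^ 2) := by
  have hK0 : 0 ≤ K := (abs_nonneg _).trans (hK 0)
  rw [mul_min_of_nonneg _ _ (by positivity)]
  refine le_min (by simpa using abs_secondDiff_le_four_mul hK x z) ?_
  have h1 : ∀ t, 0 ≤ t → |f' (x + t) - f' (x - t)| ≤ 2 * K * t := by
    intro t ht
    refine abs_le_mul_of_deriv (f := fun t => f' (x + t) - f' (x - t)) ht (by simp)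
      (fun s => (hasDerivAt_comp_add hf' x s).sub (hasDerivAt_comp_sub hf' x s)) ?_
    intro s _ _
    have h1 := abs_le.1 (hK'' (x + s))
    have h2 := abs_le.1 (hK'' (x - s))
    rw [abs_le]
    constructor <;> linarith
  have h2 := abs_le_mul_of_deriv (f := secondDiff f x) (B := 2 * K * z) hz
    (by simp [secondDiff]; ring) (hasDerivAt_secondDiff hf x)
    (fun t ht htz => (h1 t ht).trans (by gcongr))
  nlinarith [mul_nonneg hK0 (sq_nonneg z)]

theorem hasDerivAt_iteratedDeriv {f : ℝ → ℝ} {n : ℕ} (hf : ContDiff ℝ n f) {i : ℕ} (hi : i < n)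
    (x : ℝ) : HasDerivAt (iteratedDeriv i f) (iteratedDeriv (i + 1) f x) x := by
  rw [iteratedDeriv_succ]
  exact (hf.differentiable_iteratedDeriv i (by exact_mod_cast hi) x).hasDerivAt

theorem integrableOn_secondDiff {f : ℝ → ℝ} {α K x : ℝ} (hα : 0 < α) (hα2 : α < 2)
    (hf : Continuous f) (hb : ∀ z, 0 < z → |secondDiff f x z| ≤ K * min 1 (z ^ 2)) :
    IntegrableOn (fun z => secondDiff f x z * z ^ (-(1 + α))) (Ioi 0) := by
  refine Integrable.mono' ((integrableOn_levyWeight hα hα2).const_mul K) ?_ ?_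
  · refine ContinuousOn.aestronglyMeasurable ?_ measurableSet_Ioi
    refine ContinuousOn.mul (by unfold secondDiff; fun_prop) ?_
    exact fun x hx => (Real.continuousAt_rpow_const _ _ (Or.inl (ne_of_gt hx))).continuousWithinAt
  · filter_upwards [ae_restrict_mem measurableSet_Ioi] with z hz
    have hz' := Real.rpow_nonneg (le_of_lt hz) (-(1 + α))
    rw [Real.norm_eq_abs, abs_mul, abs_of_nonneg hz', levyWeight, ← mul_assoc]
    exact mul_le_mul_of_nonneg_right (hb z hz) hz'

theorem summable_levyWeight {α h : ℝ} (hα : 0 < α) (hα2 : α < 2) (hh : 0 < h) :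
    Summable fun k : ℕ => levyWeight α ((k + 1) * h) := by
  have : Summable fun k : ℕ => h * levyWeight α ((k + 1) * h) :=
    summable_of_sum_range_le (fun k => mul_nonneg hh.le (levyWeight_nonneg (by positivity)))
      (sum_levyWeight_le hα hα2 hh)
  simpa [hh.ne'] using this.mul_left h⁻¹

theorem summable_secondDiff {f : ℝ → ℝ} {α K x h : ℝ} (hα : 0 < α) (hα2 : α < 2) (hh : 0 < h)
    (hb : ∀ z, 0 < z → |secondDiff f x z| ≤ K * min 1 (z ^ 2)) :
    Summable fun k : ℕ => secondDiff f x ((k + 1) * h) * ((k + 1) * h) ^ (-(1 + α)) := by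
  refine Summable.of_norm_bounded ((summable_levyWeight hα hα2 hh).mul_left K) fun k => ?_
  have hk : 0 < ((k : ℝ) + 1) * h := by positivity
  have hz' := Real.rpow_nonneg hk.le (-(1 + α))
  rw [Real.norm_eq_abs, abs_mul, abs_of_nonneg hz', levyWeight, ← mul_assoc]
  exact mul_le_mul_of_nonneg_right (hb _ hk) hz'

/-- The limit formula for ζ at s = α - 1, rescaled to mesh h: the origin of the correction term. The
node at 0 is omitted throughout. -/
theorem tendsto_trapezoid_power {α h : ℝ} (hα : 0 < α) (hα2 : α < 2) (hh : 0 < h) :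
    Tendsto (fun N : ℕ => h * ∑ k ∈ Finset.range N, ((k + 1) * h) ^ (1 - α) +
      h / 2 * ((N + 1) * h) ^ (1 - α) - ((N + 1) * h) ^ (2 - α) / (2 - α)) atTop
      (𝓝 (h ^ (2 - α) * realZeta (α - 1))) := by
  have := (tendsto_realZeta (s := α - 1) (by linarith) (by linarith)).const_mul (h ^ (2 - α))
  refine this.congr fun N => ?_
  have e : h ^ (2 - α) = h * h ^ (1 - α) := by
    rw [show 2 - α = 1 + (1 - α) by ring, Real.rpow_add hh, Real.rpow_one]
  have h1 : ∀ k : ℕ, (((k : ℝ) + 1) * h) ^ (1 - α) = ((k : ℝ) + 1) ^ (1 - α) * h ^ (1 - α) :=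
    fun k => Real.mul_rpow (by positivity) hh.le
  have h2 : (((N : ℝ) + 1) * h) ^ (2 - α) = ((N : ℝ) + 1) ^ (2 - α) * h ^ (2 - α) :=
    Real.mul_rpow (by positivity) hh.le
  simp_rw [h1, h2, ← Finset.sum_mul]
  rw [show -(α - 1) = 1 - α by ring, show 1 - (α - 1) = 2 - α by ring, e]
  ring

/-- Second-order accuracy of the modified trapezoidal rule for the hypersingular integral. -/
theorem modified_trapezoid_error_le {α K x h : ℝ} {f : ℝ → ℝ} (hα : 0 < α) (hα2 : α < 2)
    (hf : ContDiff ℝ 4 f) (hK : ∀ i ≤ 4, ∀ y, |iteratedDeriv i f y| ≤ K)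
    (hh : 0 < h) (hh1 : h ≤ 1) :
    |h * ∑' k : ℕ, secondDiff f x ((k + 1) * h) * ((k + 1) * h) ^ (-(1 + α)) -
        realZeta (α - 1) * h ^ (-α) * secondDiff f x h -
        ∫ z in Ioi 0, secondDiff f x z * z ^ (-(1 + α))| ≤
      (8 + 320 * levyMass α + 4 * |realZeta (α - 1)|) * K * h ^ 2 := by
  have hf0 : iteratedDeriv 0 f = f := iteratedDeriv_zero
  have hD : ∀ i < 4, ∀ t, HasDerivAt (iteratedDeriv i f) (iteratedDeriv (i + 1) f t) t :=
    fun i hi t => hasDerivAt_iteratedDeriv (n := 4) (by exact_mod_cast hf) hi t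
  have hD0 : ∀ t, HasDerivAt f (iteratedDeriv 1 f t) t := by simpa [hf0] using hD 0 (by norm_num)
  have hK0 : 0 ≤ K := (abs_nonneg _).trans (hK 0 (by norm_num) 0)
  set a := iteratedDeriv 2 f x with ha
  -- Removing the quadratic Taylor term leaves r = O(z⁴), with r'' again a second difference, of
  -- f''. The bounds on r' and r follow by integrating up from 0.
  set r : ℝ → ℝ := fun z => secondDiff f x z - a * z ^ 2 with hr
  set r' : ℝ → ℝ := fun z => iteratedDeriv 1 f (x + z) - iteratedDeriv 1 f (x - z) - a * (2 * z)
    with hr'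
  have hrd : ∀ z, HasDerivAt r (r' z) z := fun z => by
    refine ((hasDerivAt_secondDiff hD0 x z).sub ((hasDerivAt_pow 2 z).const_mul a)).congr_deriv ?_
    simp [hr']
  have hrd' : ∀ z, HasDerivAt r' (secondDiff (iteratedDeriv 2 f) x z) z := fun z => by
    refine (((hasDerivAt_comp_add (hD 1 (by norm_num)) x z).sub
      (hasDerivAt_comp_sub (hD 1 (by norm_num)) x z)).sub
      (((hasDerivAt_id z).const_mul 2).const_mul a)).congr_deriv ?_
    simp only [secondDiff, ha]
    ring
  have hb'' : ∀ z, 0 ≤ z → |secondDiff (iteratedDeriv 2 f) x z| ≤ 4 * K * min 1 (z ^ 2) :=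
    fun z hz => abs_secondDiff_le (hD 2 (by norm_num)) (hD 3 (by norm_num))
      (hK 2 (by norm_num)) (hK 4 le_rfl) x hz
  have hmono : ∀ {t z : ℝ}, 0 ≤ t → t ≤ z → 4 * K * min 1 (t ^ 2) ≤ 4 * K * min 1 (z ^ 2) :=
    fun ht htz => by gcongr
  have hb' : ∀ z, 0 ≤ z → |r' z| ≤ 4 * K * min 1 (z ^ 2) * z := fun z hz =>
    abs_le_mul_of_deriv hz (by simp [hr']) hrd' fun t ht htz =>
      (hb'' t ht).trans (hmono ht htz)
  have hb : ∀ z, 0 ≤ z → |r z| ≤ 4 * K * min 1 (z ^ 2) * z ^ 2 := fun z hz => by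
    have := abs_le_mul_of_deriv (B := 4 * K * min 1 (z ^ 2) * z) hz
      (by simp [hr, secondDiff]; ring) hrd fun t ht htz =>
      (hb' t ht).trans (mul_le_mul (hmono ht htz) htz ht (by positivity))
    calc _ ≤ _ := this
      _ = _ := by ring
  have hsb : ∀ z, 0 < z → |secondDiff f x z| ≤ 4 * K * min 1 (z ^ 2) := fun z hz =>
    abs_secondDiff_le hD0 (hD 1 (by norm_num)) (by simpa [hf0] using hK 0 (by norm_num))
      (hK 2 (by norm_num)) x hz.le
  have hint := integrableOn_secondDiff hα hα2 hf.continuous hsb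
  have hsum := summable_secondDiff hα hα2 hh hsb
  have hFii : ∀ b, 0 ≤ b → IntervalIntegrable
      (fun z => secondDiff f x z * z ^ (-(1 + α))) volume 0 b := fun b hb => by
    rw [intervalIntegrable_iff_integrableOn_Ioc_of_le hb]
    exact hint.mono_set Ioc_subset_Ioi_self
  have hpii : ∀ b : ℝ, IntervalIntegrable (fun z : ℝ => a * z ^ (1 - α)) volume 0 b := fun b =>
    (intervalIntegral.intervalIntegrable_rpow' (by linarith)).const_mul a
  have hrF : ∀ z, 0 < z → r z * z ^ (-(1 + α)) =
      secondDiff f x z * z ^ (-(1 + α)) - a * z ^ (1 - α) := fun z hz => by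
    rw [← sq_mul_rpow hz]; simp only [hr]; ring
  have hrii : ∀ b, 0 ≤ b → IntervalIntegrable (fun z => r z * z ^ (-(1 + α))) volume 0 b :=
    fun b hb => by
      refine ((hFii b hb).sub (hpii b)).congr fun z hz => ?_
      rw [uIoc_of_le hb] at hz
      exact (hrF z hz.1).symm
  set S := ∑' k : ℕ, secondDiff f x ((k + 1) * h) * ((k + 1) * h) ^ (-(1 + α)) with hS
  set I := ∫ z in Ioi 0, secondDiff f x z * z ^ (-(1 + α)) with hI
  have hlim1 : Tendsto (fun N : ℕ =>
      h * ∑ k ∈ Finset.range N, secondDiff f x ((k + 1) * h) * ((k + 1) * h) ^ (-(1 + α)) +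
        h / 2 * (secondDiff f x ((N + 1) * h) * ((N + 1) * h) ^ (-(1 + α))) -
        ∫ z in 0..((N + 1) * h), secondDiff f x z * z ^ (-(1 + α))) atTop
      (𝓝 (h * S + h / 2 * 0 - I)) := by
    refine ((hsum.hasSum.tendsto_sum_nat.const_mul h).add
      (hsum.tendsto_atTop_zero.const_mul (h / 2))).sub
      (intervalIntegral_tendsto_integral_Ioi 0 hint ?_)
    exact (tendsto_atTop_add_const_right _ _ tendsto_natCast_atTop_atTop).atTop_mul_const hh
  have hlim := hlim1.sub ((tendsto_trapezoid_power hα hα2 hh).const_mul a)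
  -- The bound for r on N + 1 cells is uniform in N, so it survives the limit, while the pure power
  -- contributes its exact limiting error.
  have hbd : |h * S + h / 2 * 0 - I - a * (h ^ (2 - α) * realZeta (α - 1))| ≤
      2 * (4 * K) * h ^ 2 + 10 * (4 * K) * h ^ 2 * (8 * levyMass α) := by
    refine le_of_tendsto' hlim.abs fun N => ?_
    have h1 := trapezoid_weighted_error_le hα hα2 hh hh1 (fun z _ => hrd z) (fun z _ => hrd' z)
      (fun z hz => hb z hz.le) (fun z hz => hb' z hz.le) (fun z hz => hb'' z hz.le) N hrii
    have hN : 0 < ((N : ℝ) + 1) * h := by positivity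
    have h2 : ∫ z in 0..((N + 1) * h), r z * z ^ (-(1 + α)) =
        (∫ z in 0..((N + 1) * h), secondDiff f x z * z ^ (-(1 + α))) -
          a * (((N + 1) * h) ^ (2 - α) / (2 - α)) := by
      have h3 : ∫ z in 0..((N + 1) * h), z ^ (1 - α) = ((N + 1) * h) ^ (2 - α) / (2 - α) := by
        rw [integral_rpow (Or.inl (by linarith)), show 1 - α + 1 = 2 - α by ring,
          Real.zero_rpow (by linarith), sub_zero]
      rw [← h3, ← intervalIntegral.integral_const_mul,
        ← intervalIntegral.integral_sub (hFii _ hN.le) (hpii _)]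
      refine intervalIntegral.integral_congr_ae (Eventually.of_forall fun z hz => ?_)
      rw [uIoc_of_le hN.le] at hz
      exact hrF z hz.1
    have h4 : ∑ k ∈ Finset.range N, r ((k + 1) * h) * ((k + 1) * h) ^ (-(1 + α)) =
        (∑ k ∈ Finset.range N, secondDiff f x ((k + 1) * h) * ((k + 1) * h) ^ (-(1 + α))) -
          a * ∑ k ∈ Finset.range N, ((k + 1) * h) ^ (1 - α) := by
      rw [Finset.mul_sum, ← Finset.sum_sub_distrib]
      exact Finset.sum_congr rfl fun k _ => hrF _ (by positivity)
    rw [h2, h4, hrF _ hN] at h1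
    have h5 := sum_levyWeight_le hα hα2 hh N
    have h6 : 0 ≤ 10 * (4 * K) * h ^ 2 := by positivity
    refine le_trans (le_of_eq ?_) (h1.trans (add_le_add_right (mul_le_mul_of_nonneg_left h5 h6) _))
    congr 1
    ring
  -- The scheme uses S(h) where the exact correction has a h². The discrepancy is h^{-α} r(h) =
  -- O(h^{4-α}), which is O(h²) since h ≤ 1 and α < 2.
  have hz : |realZeta (α - 1) * h ^ (-α) * r h| ≤ |realZeta (α - 1)| * (4 * K * h ^ 2) := by
    rw [mul_assoc, abs_mul, abs_mul, abs_of_nonneg (Real.rpow_nonneg hh.le _)]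
    refine mul_le_mul_of_nonneg_left ?_ (abs_nonneg _)
    calc h ^ (-α) * |r h| ≤ h ^ (-α) * (4 * K * min 1 (h ^ 2) * h ^ 2) :=
          mul_le_mul_of_nonneg_left (hb h hh.le) (Real.rpow_nonneg hh.le _)
      _ ≤ h ^ (-α) * (4 * K * h ^ 2 * h ^ 2) := by
          have := min_le_right 1 (h ^ 2)
          have := Real.rpow_nonneg hh.le (-α)
          gcongr
      _ = 4 * K * h ^ 2 * h ^ (2 - α) := by
          rw [show (2 : ℝ) - α = 2 + (-α) by ring, Real.rpow_add hh, Real.rpow_two]; ring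
      _ ≤ 4 * K * h ^ 2 * 1 := by
          refine mul_le_mul_of_nonneg_left ?_ (by positivity)
          exact Real.rpow_le_one hh.le hh1 (by linarith)
      _ = _ := mul_one _
  have hsplit : h * S - realZeta (α - 1) * h ^ (-α) * secondDiff f x h - I =
      (h * S + h / 2 * 0 - I - a * (h ^ (2 - α) * realZeta (α - 1))) -
        realZeta (α - 1) * h ^ (-α) * r h := by
    simp only [hr]
    rw [show (2 : ℝ) - α = 2 + (-α) by ring, Real.rpow_add hh, Real.rpow_two]
    ring
  rw [hsplit]
  refine (abs_sub _ _).trans ((add_le_add hbd hz).trans (le_of_eq ?_))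
  ring

/-- A principal value is the absolutely convergent integral of the second difference. -/
theorem HasPVStable.eq_integral {α x v : ℝ} {f : ℝ → ℝ} (h : HasPVStable α f x v)
    (hint : IntegrableOn (fun z => secondDiff f x z * z ^ (-(1 + α))) (Ioi 0)) :
    v = stableConst α * ∫ z in Ioi 0, secondDiff f x z * z ^ (-(1 + α)) := by
  set G : ℝ → ℝ := fun z => (f (x + z) - f x) * (stableConst α / |z| ^ (1 + α)) with hG
  have hlim : Tendsto (fun ε : ℝ => ∫ z in Ioi ε, secondDiff f x z * z ^ (-(1 + α))) (𝓝[>] 0)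
      (𝓝 (∫ z in Ioi 0, secondDiff f x z * z ^ (-(1 + α)))) := by
    have hc : AECover (volume.restrict (Ioi (0 : ℝ))) (𝓝[>] (0 : ℝ)) (fun ε : ℝ => Ioi ε) :=
      aecover_Ioi_of_Ioi (tendsto_id.mono_left nhdsWithin_le_nhds)
    refine (hc.integral_tendsto_of_countably_generated hint).congr' ?_
    filter_upwards [self_mem_nhdsWithin] with ε hε
    rw [Measure.restrict_restrict measurableSet_Ioi,
      inter_eq_left.2 (Ioi_subset_Ioi (le_of_lt hε))]
  refine tendsto_nhds_unique h.2 ((hlim.const_mul (stableConst α)).congr' ?_)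
  filter_upwards [self_mem_nhdsWithin] with ε hε
  have hε : 0 < ε := hε
  have hset : {z : ℝ | ε < |z|} = Ioi ε ∪ Iio (-ε) := by
    ext z
    simp only [mem_ofPred_eq, lt_abs, mem_union, mem_Ioi, mem_Iio]
    constructor <;> rintro (h | h) <;> [left; right; left; right] <;> linarith
  have hi := h.1 ε hε
  rw [hset] at hi
  have hi1 : IntegrableOn G (Ioi ε) := hi.mono_set subset_union_left
  have hi2 : IntegrableOn G (Iio (-ε)) := hi.mono_set subset_union_right
  have hi3 : IntegrableOn (fun z => G (-z)) (Ioi ε) := hi2.comp_neg_Ioi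
  -- Reflecting z < -ε onto z > ε pairs the two half-lines; the integrability clause of
  -- `HasPVStable` justifies the split.
  rw [hset, setIntegral_union (by
      rw [Set.disjoint_left]; intro z hz hz'; simp only [mem_Ioi, mem_Iio] at hz hz'; linarith)
    measurableSet_Iio hi1 hi2, ← integral_Iic_eq_integral_Iio, ← integral_comp_neg_Ioi,
    ← integral_add hi1 hi3, ← integral_const_mul]
  refine setIntegral_congr_fun measurableSet_Ioi fun z hz => ?_
  have hz0 : 0 < z := hε.trans hz
  simp only [abs_neg, abs_of_pos hz0, secondDiff, Real.rpow_neg hz0.le, hG]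
  rw [← sub_eq_add_neg]
  ring

/-! ### The truncated lattice sum -/

/-- The weights of the doubly primed sum, extended by zero. -/
def endWeight (J : ℕ) (j k : ℤ) : ℝ :=
  if k ∈ Finset.Icc (-(J : ℤ) - j) ((J : ℤ) - j) then
    if k = -(J : ℤ) - j ∨ k = (J : ℤ) - j then 1 / 2 else 1
  else 0

theorem endWeight_nonneg (J : ℕ) (j k : ℤ) : 0 ≤ endWeight J j k := by
  unfold endWeight; split_ifs <;> norm_num

theorem endWeight_le_one (J : ℕ) (j k : ℤ) : endWeight J j k ≤ 1 := by
  unfold endWeight; split_ifs <;> norm_num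

theorem endWeight_eq_one {J : ℕ} {j k : ℤ} (h : |k| < J - |j|) : endWeight J j k = 1 := by
  have hk := abs_lt.1 h
  have h1 := neg_abs_le j
  have h2 := le_abs_self j
  rw [endWeight, if_pos (Finset.mem_Icc.2 ⟨by omega, by omega⟩), if_neg (by omega)]

theorem sum_Icc_erase_zero (f : ℤ → ℝ) (N : ℕ) :
    ∑ k ∈ (Finset.Icc (-(N : ℤ)) N).erase 0, f k =
      ∑ i ∈ Finset.range N, (f ((i : ℤ) + 1) + f (-((i : ℤ) + 1))) := by
  induction N with
  | zero => simp
  | succ n ih =>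
    have : (Finset.Icc (-((n + 1 : ℕ) : ℤ)) ((n + 1 : ℕ) : ℤ)).erase 0 =
        insert ((n : ℤ) + 1) (insert (-((n : ℤ) + 1)) ((Finset.Icc (-(n : ℤ)) n).erase 0)) := by
      ext k
      simp only [Finset.mem_erase, Finset.mem_Icc, Finset.mem_insert]
      push_cast
      omega
    rw [this, Finset.sum_insert, Finset.sum_insert, ih, Finset.sum_range_succ]
    · ring
    · simp only [Finset.mem_erase, Finset.mem_Icc]; omega
    · simp only [Finset.mem_erase, Finset.mem_Icc, Finset.mem_insert]; omega

/-- Pairing k with -k makes the off-centre window comparable with the symmetric series of second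
differences. For |j| ≤ J the window lies in [-2J, 2J], hence the condition on N. -/
theorem primedSum_eq_sum_range {α h : ℝ} (hh : 0 < h) {J : ℕ} (V : ℤ → ℝ) {j : ℤ} (hj : |j| ≤ J)
    {N : ℕ} (hN : 2 * J ≤ N) :
    primedSum α h J V j = ∑ i ∈ Finset.range N,
      (endWeight J j ((i : ℤ) + 1) * (V (j + ((i : ℤ) + 1)) - V j) +
        endWeight J j (-((i : ℤ) + 1)) * (V (j - ((i : ℤ) + 1)) - V j)) *
          ((i + 1) * h) ^ (-(1 + α)) := by
  have hj' := abs_le.1 hj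
  have h1 : primedSum α h J V j = ∑ k ∈ (Finset.Icc (-(N : ℤ)) N).erase 0,
      endWeight J j k * ((V (j + k) - V j) / |(k : ℝ) * h| ^ (1 + α)) := by
    have hsub : (Finset.Icc (-(J : ℤ) - j) ((J : ℤ) - j)).erase 0 ⊆
        (Finset.Icc (-(N : ℤ)) N).erase 0 :=
      Finset.erase_subset_erase _ (Finset.Icc_subset_Icc (by omega) (by omega))
    rw [primedSum, ← Finset.sum_subset hsub]
    · refine Finset.sum_congr rfl fun k hk => ?_
      rw [endWeight, if_pos (Finset.mem_of_mem_erase hk)]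
    · intro k hk hk'
      rw [endWeight, if_neg, zero_mul]
      exact fun h => hk' (Finset.mem_erase.2 ⟨Finset.ne_of_mem_erase hk, h⟩)
  rw [h1, sum_Icc_erase_zero]
  refine Finset.sum_congr rfl fun i _ => ?_
  have hi : (0 : ℝ) < (i + 1) * h := by positivity
  have e1 : |(((i : ℤ) + 1 : ℤ) : ℝ) * h| = (i + 1) * h := by
    push_cast; exact abs_of_pos hi
  have e2 : |((-((i : ℤ) + 1) : ℤ) : ℝ) * h| = (i + 1) * h := by
    push_cast; rw [neg_mul, abs_neg]; exact abs_of_pos hi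
  rw [e1, e2, Real.rpow_neg hi.le, ← sub_eq_add_neg]
  ring

/-- Truncating the lattice sum to `[-J, J]` costs `O((J - |j|)^{-α})`. -/
theorem abs_primedSum_sub_le {α h K : ℝ} (hα : 0 < α) (hh : 0 < h) {J : ℕ} {V : ℤ → ℝ}
    (hV : ∀ i, |V i| ≤ K) {j : ℤ} (hj : |j| < J) {N : ℕ} (hN : 2 * J ≤ N) :
    |primedSum α h J V j - ∑ i ∈ Finset.range N,
      (V (j + ((i : ℤ) + 1)) + V (j - ((i : ℤ) + 1)) - 2 * V j) * ((i + 1) * h) ^ (-(1 + α))| ≤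
      4 * K * (1 + 1 / α) * h ^ (-(1 + α)) * ((J : ℝ) - |(j : ℝ)|) ^ (-α) := by
  have hK : 0 ≤ K := (abs_nonneg _).trans (hV 0)
  -- For offsets up to m both neighbours are strictly inside the window and carry full weight, so
  -- the error starts at offset m + 1, the distance to the nearer end.
  obtain ⟨m, hm⟩ : ∃ m : ℕ, (J : ℤ) - |j| = m + 1 := ⟨((J : ℤ) - |j| - 1).toNat, by omega⟩
  have hmR : (J : ℝ) - |(j : ℝ)| = 1 + m := by
    have : (((J : ℤ) - |j| : ℤ) : ℝ) = ((m + 1 : ℤ) : ℝ) := by rw [hm]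
    push_cast at this
    rw [this]; ring
  obtain ⟨l, rfl⟩ : ∃ l, N = m + l := ⟨N - m, by have := abs_nonneg j; omega⟩
  rw [primedSum_eq_sum_range hh V hj.le hN, ← Finset.sum_sub_distrib]
  set b : ℕ → ℝ := fun i => ((i + 1) * h) ^ (-(1 + α)) with hb
  have hb0 : ∀ i, 0 ≤ b i := fun i => Real.rpow_nonneg (by positivity) _
  set e : ℕ → ℝ := fun i =>
    (endWeight J j ((i : ℤ) + 1) * (V (j + ((i : ℤ) + 1)) - V j) +
        endWeight J j (-((i : ℤ) + 1)) * (V (j - ((i : ℤ) + 1)) - V j)) * b i -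
      (V (j + ((i : ℤ) + 1)) + V (j - ((i : ℤ) + 1)) - 2 * V j) * b i with he
  have hzero : ∀ i < m, e i = 0 := fun i hi => by
    have h1 : |((i : ℤ) + 1)| < J - |j| := by rw [abs_of_nonneg (by positivity)]; omega
    simp only [he, endWeight_eq_one h1, endWeight_eq_one (show |-((i : ℤ) + 1)| < J - |j| by
      rwa [abs_neg])]
    ring
  have hdiff : ∀ i, |V i - V j| ≤ 2 * K := fun i =>
    (abs_sub _ _).trans (by linarith [hV i, hV j])
  have hwt : ∀ k, |endWeight J j k - 1| ≤ 1 := fun k => by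
    rw [abs_le]; constructor <;> linarith [endWeight_nonneg J j k, endWeight_le_one J j k]
  have hbound : ∀ i, |e i| ≤ 4 * K * b i := fun i => by
    have : e i = ((endWeight J j ((i : ℤ) + 1) - 1) * (V (j + ((i : ℤ) + 1)) - V j) +
        (endWeight J j (-((i : ℤ) + 1)) - 1) * (V (j - ((i : ℤ) + 1)) - V j)) * b i := by
      simp only [he]; ring
    rw [this, abs_mul, abs_of_nonneg (hb0 i)]
    refine mul_le_mul_of_nonneg_right ((abs_add_le _ _).trans ?_) (hb0 i)
    rw [abs_mul, abs_mul]
    have h1 := mul_le_mul (hwt ((i : ℤ) + 1)) (hdiff (j + ((i : ℤ) + 1))) (abs_nonneg _) zero_le_one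
    have h2 := mul_le_mul (hwt (-((i : ℤ) + 1))) (hdiff (j - ((i : ℤ) + 1))) (abs_nonneg _)
      zero_le_one
    linarith
  have hsplit : ∑ i ∈ Finset.range (m + l), e i = ∑ i ∈ Finset.range l, e (m + i) := by
    rw [Finset.sum_range_add, Finset.sum_eq_zero (fun i hi => hzero i (Finset.mem_range.1 hi)),
      zero_add]
  rw [hsplit]
  have hbe : ∀ i, b (m + i) = h ^ (-(1 + α)) * (1 + (m : ℝ) + i) ^ (-(1 + α)) := fun i => by
    simp only [hb]
    rw [mul_comm ((((m + i : ℕ) : ℝ) + 1)), Real.mul_rpow hh.le (by positivity)]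
    congr 2
    push_cast; ring
  have htail := sum_rpow_tail_le hα (show (1 : ℝ) ≤ 1 + m by linarith [(Nat.cast_nonneg m : (0 : ℝ) ≤ m)]) l
  have hhp := Real.rpow_nonneg hh.le (-(1 + α))
  calc |∑ i ∈ Finset.range l, e (m + i)| ≤ ∑ i ∈ Finset.range l, |e (m + i)| :=
        Finset.abs_sum_le_sum_abs _ _
    _ ≤ ∑ i ∈ Finset.range l, 4 * K * h ^ (-(1 + α)) * (1 + (m : ℝ) + i) ^ (-(1 + α)) :=
        Finset.sum_le_sum fun i _ => (hbound _).trans (le_of_eq (by rw [hbe]; ring))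
    _ = 4 * K * h ^ (-(1 + α)) * ∑ i ∈ Finset.range l, (1 + (m : ℝ) + i) ^ (-(1 + α)) := by
        rw [Finset.mul_sum]
    _ ≤ 4 * K * h ^ (-(1 + α)) * ((1 + 1 / α) * (1 + (m : ℝ)) ^ (-α)) :=
        mul_le_mul_of_nonneg_left htail (by positivity)
    _ = _ := by rw [hmR]; ring

/-- The worst case is that all neighbours vanish; weights at most 1 and `sum_rpow_tail_le` at x = 1
then bound the diagonal coefficient. -/
theorem neg_le_primedSum {α h : ℝ} (hα : 0 < α) (hh : 0 < h) {J : ℕ} {V : ℤ → ℝ}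
    (hV : ∀ i, 0 ≤ V i) {j : ℤ} (hj : |j| ≤ J) :
    -(2 * (1 + 1 / α) * h ^ (-(1 + α)) * V j) ≤ primedSum α h J V j := by
  rw [primedSum_eq_sum_range hh V hj le_rfl]
  have htail := sum_rpow_tail_le hα (le_refl (1 : ℝ)) (2 * J)
  rw [Real.one_rpow, mul_one] at htail
  have hhp := Real.rpow_nonneg hh.le (-(1 + α))
  calc -(2 * (1 + 1 / α) * h ^ (-(1 + α)) * V j)
      ≤ -(2 * (∑ k ∈ Finset.range (2 * J), (1 + (k : ℝ)) ^ (-(1 + α))) * h ^ (-(1 + α)) * V j) := by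
        have := hV j
        gcongr
    _ = ∑ i ∈ Finset.range (2 * J), -(2 * V j) * (((i : ℝ) + 1) * h) ^ (-(1 + α)) := by
        rw [← Finset.mul_sum]
        have : ∀ i : ℕ, (((i : ℝ) + 1) * h) ^ (-(1 + α)) =
            (1 + (i : ℝ)) ^ (-(1 + α)) * h ^ (-(1 + α)) := fun i => by
          rw [add_comm (i : ℝ), Real.mul_rpow (by positivity) hh.le]
        simp_rw [this, ← Finset.sum_mul]
        ring
    _ ≤ _ := by
        refine Finset.sum_le_sum fun i _ => ?_
        refine mul_le_mul_of_nonneg_right ?_ (Real.rpow_nonneg (by positivity) _)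
        have key : ∀ k l, -V j ≤ endWeight J j k * (V l - V j) := fun k l => by
          have h1 := endWeight_nonneg J j k
          have h2 := endWeight_le_one J j k
          nlinarith [mul_nonneg h1 (hV l), mul_nonneg (sub_nonneg.2 h2) (hV j)]
        linarith [key ((i : ℤ) + 1) (j + ((i : ℤ) + 1)), key (-((i : ℤ) + 1)) (j - ((i : ℤ) + 1))]

/-! ### Linearity, monotonicity and the discrete maximum principle -/

theorem primedSum_sub (α h : ℝ) (J : ℕ) (V W : ℤ → ℝ) (j : ℤ) :
    primedSum α h J (fun i => V i - W i) j = primedSum α h J V j - primedSum α h J W j := by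
  simp only [primedSum]
  rw [← Finset.sum_sub_distrib]
  exact Finset.sum_congr rfl fun k _ => by ring

theorem primedSum_mul_add_const (α h : ℝ) (J : ℕ) (a b : ℝ) (V : ℤ → ℝ) (j : ℤ) :
    primedSum α h J (fun i => a * V i + b) j = a * primedSum α h J V j := by
  simp only [primedSum]
  rw [Finset.mul_sum]
  exact Finset.sum_congr rfl fun k _ => by ring

theorem discreteOp_sub (α : ℝ) (σ : ℝ → ℝ) (h : ℝ) (J : ℕ) (V W : ℤ → ℝ) (j : ℤ) :
    discreteOp α σ h J (fun i => V i - W i) j =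
      discreteOp α σ h J V j - discreteOp α σ h J W j := by
  simp only [discreteOp, primedSum_sub]
  ring

theorem discreteOp_mul_add_const (α : ℝ) (σ : ℝ → ℝ) (h : ℝ) (J : ℕ) (a b : ℝ) (V : ℤ → ℝ)
    (j : ℤ) :
    discreteOp α σ h J (fun i => a * V i + b) j = a * discreteOp α σ h J V j := by
  simp only [discreteOp, primedSum_mul_add_const]
  ring

theorem stableConst_pos {α : ℝ} (hα : 0 < α) (hα2 : α < 2) : 0 < stableConst α := by
  have h1 := Real.Gamma_pos_of_pos (show 0 < (1 + α) / 2 by linarith)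
  have h2 := Real.Gamma_pos_of_pos (show 0 < 1 - α / 2 by linarith)
  have h3 := Real.pi_pos
  unfold stableConst
  positivity

theorem coeff_nonneg {α : ℝ} (hα : 0 < α) (hα2 : α < 2) (s : ℝ) :
    0 ≤ stableConst α * |s| ^ α :=
  mul_nonneg (stableConst_pos hα hα2).le (Real.rpow_nonneg (abs_nonneg _) _)

theorem coeff_le {α M s : ℝ} (hα : 0 < α) (hα2 : α < 2) (hs : |s| ≤ M) :
    stableConst α * |s| ^ α ≤ stableConst α * M ^ α :=
  mul_le_mul_of_nonneg_left (Real.rpow_le_rpow (abs_nonneg _) hs hα.le) (stableConst_pos hα hα2).le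

theorem mul_rpow_neg_one_add {α h : ℝ} (hh : 0 < h) : h * h ^ (-(1 + α)) = h ^ (-α) := by
  rw [show -(1 + α) = -α - 1 by ring, Real.rpow_sub_one hh.ne']
  field_simp

/-- Under the CFL condition one Euler step preserves nonnegativity. -/
theorem euler_step_nonneg {α : ℝ} (hα : 0 < α) (hα2 : α < 2) {σ : ℝ → ℝ} {M : ℝ} (hM : 0 < M)
    (hσ : ∀ x, |σ x| ≤ M) {dt h : ℝ} (hdt : 0 < dt) (hh : 0 < h) (hcfl : CFL α M dt h)
    {J : ℕ} {V : ℤ → ℝ} (hV : ∀ i, 0 ≤ V i) {j : ℤ} (hj : |j| ≤ J) :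
    0 ≤ V j + dt * discreteOp α σ h J V j := by
  have hz : realZeta (α - 1) < 0 := realZeta_neg (by linarith) (by linarith)
  have hcpos := stableConst_pos hα hα2
  have hhα : 0 < h ^ α := Real.rpow_pos_of_pos hh _
  set D := 1 + 1 / α - realZeta (α - 1) with hD
  have hDpos : 0 < D := by
    have : 0 < 1 / α := by positivity
    linarith
  set c := stableConst α * |σ (j * h)| ^ α with hc
  have hc0 : 0 ≤ c := coeff_nonneg hα hα2 _
  have hcM : c ≤ stableConst α * M ^ α := coeff_le hα hα2 (hσ _)
  have hMα : 0 < M ^ α := Real.rpow_pos_of_pos hM _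
  have hdtc : dt * h ^ (-α) * (2 * c * D) ≤ 1 := by
    have h1 : dt / h ^ α * (2 * M ^ α * stableConst α * D) ≤ 1 := by
      have := hcfl
      rw [CFL] at this
      rwa [le_div_iff₀ (by positivity)] at this
    rw [Real.rpow_neg hh.le, ← div_eq_mul_inv]
    refine le_trans ?_ h1
    refine mul_le_mul_of_nonneg_left ?_ (by positivity)
    nlinarith
  -- Only the diagonal is kept: the sum contributes 2(1 + 1/α) and the central difference -2ζ(α-1),
  -- together 2D. The discarded neighbour terms are nonnegative because ζ(α-1) < 0.
  have hA : -(2 * c * D * h ^ (-α) * V j) ≤ discreteOp α σ h J V j := by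
    have h1 := neg_le_primedSum hα hh hV hj
    have h2 : c * h * -(2 * (1 + 1 / α) * h ^ (-(1 + α)) * V j) ≤ c * h * primedSum α h J V j :=
      mul_le_mul_of_nonneg_left h1 (by positivity)
    have h3 : c * h * -(2 * (1 + 1 / α) * h ^ (-(1 + α)) * V j) =
        -(2 * c * (1 + 1 / α) * h ^ (-α) * V j) := by
      rw [← mul_rpow_neg_one_add (α := α) hh]; ring
    have h4 : 0 ≤ c * (-realZeta (α - 1)) * h ^ (-α) * (V (j + 1) + V (j - 1)) := by
      have := hV (j + 1)
      have := hV (j - 1)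
      have : 0 ≤ -realZeta (α - 1) := by linarith
      positivity
    rw [discreteOp, ← hc]
    rw [h3] at h2
    rw [hD]
    linarith
  nlinarith [mul_le_mul_of_nonneg_left hA hdt.le, mul_le_mul_of_nonneg_right hdtc (hV j)]

/-- Under the CFL condition one Euler step is monotone. -/
theorem euler_step_mono {α : ℝ} (hα : 0 < α) (hα2 : α < 2) {σ : ℝ → ℝ} {M : ℝ} (hM : 0 < M)
    (hσ : ∀ x, |σ x| ≤ M) {dt h : ℝ} (hdt : 0 < dt) (hh : 0 < h) (hcfl : CFL α M dt h)
    {J : ℕ} {V W : ℤ → ℝ} (hVW : ∀ i, V i ≤ W i) {j : ℤ} (hj : |j| ≤ J) :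
    V j + dt * discreteOp α σ h J V j ≤ W j + dt * discreteOp α σ h J W j := by
  have := euler_step_nonneg hα hα2 hM hσ hdt hh hcfl (V := fun i => W i - V i)
    (fun i => sub_nonneg.2 (hVW i)) hj
  rw [discreteOp_sub] at this
  linarith

theorem discreteOp_const (α : ℝ) (σ : ℝ → ℝ) (h : ℝ) (J : ℕ) (b : ℝ) (j : ℤ) :
    discreteOp α σ h J (fun _ => b) j = 0 := by
  simpa using discreteOp_mul_add_const α σ h J 0 b (fun _ => 0) j

/-- Discrete maximum principle. -/
theorem abs_numSol_le {α : ℝ} (hα : 0 < α) (hα2 : α < 2) {σ u₀ : ℝ → ℝ} {M K : ℝ} (hM : 0 < M)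
    (hσ : ∀ x, |σ x| ≤ M) {dt h : ℝ} (hdt : 0 < dt) (hh : 0 < h) (hcfl : CFL α M dt h)
    (hu₀ : ∀ x, |u₀ x| ≤ K) (J n : ℕ) (j : ℤ) : |numSol α σ u₀ dt h J n j| ≤ K := by
  have hK : 0 ≤ K := (abs_nonneg _).trans (hu₀ 0)
  induction n generalizing j with
  | zero =>
    rw [numSol]
    split_ifs
    · exact hu₀ _
    · simpa using hK
  | succ n ih =>
    rw [numSol]
    split_ifs with hj
    · have h1 := euler_step_mono hα hα2 hM hσ hdt hh hcfl (J := J)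
        (fun i => (abs_le.1 (ih i)).2) hj.le
      have h2 := euler_step_mono hα hα2 hM hσ hdt hh hcfl (J := J)
        (fun i => (abs_le.1 (ih i)).1) hj.le
      rw [discreteOp_const] at h1 h2
      rw [abs_le]
      constructor <;> linarith
    · simpa using hK

/-! ### Consistency in time and space -/

/-- Consistency of the forward difference quotient in time. -/
theorem abs_forward_diff_sub_le {f : ℝ → ℝ} {T K t dt v : ℝ} (hT : 0 < T)
    (hf : ContDiffOn ℝ 2 f (Icc 0 T)) (hK : ∀ s ∈ Icc 0 T, |iteratedDerivWithin 2 f (Icc 0 T) s| ≤ K)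
    (ht : 0 ≤ t) (hdt : 0 < dt) (htT : t + dt ≤ T) (hv : HasDerivWithinAt f v (Icc 0 T) t) :
    |(f (t + dt) - f t) / dt - v| ≤ K * dt := by
  have hU : UniqueDiffOn ℝ (Icc 0 T) := uniqueDiffOn_Icc hT
  have htm : t ∈ Icc 0 T := ⟨ht, by linarith⟩
  have hK0 : 0 ≤ K := (abs_nonneg _).trans (hK t htm)
  have h1 : ∀ s ∈ Icc 0 T, HasDerivWithinAt f (derivWithin f (Icc 0 T) s) (Icc 0 T) s :=
    fun s hs => (hf.differentiableOn (by norm_num) s hs).hasDerivWithinAt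
  have hveq : derivWithin f (Icc 0 T) t = v := hv.derivWithin (hU t htm)
  have h2 : ∀ s ∈ Icc 0 T, HasDerivWithinAt (derivWithin f (Icc 0 T))
      (iteratedDerivWithin 2 f (Icc 0 T) s) (Icc 0 T) s := fun s hs => by
    have hd : DifferentiableOn ℝ (iteratedDerivWithin 1 f (Icc 0 T)) (Icc 0 T) :=
      hf.differentiableOn_iteratedDerivWithin (by norm_num) hU
    have := (hd s hs).hasDerivWithinAt
    rw [← iteratedDerivWithin_succ] at this
    rwa [iteratedDerivWithin_one] at this
  have hsub : Icc t (t + dt) ⊆ Icc 0 T := Icc_subset_Icc ht htT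
  have h3 : ∀ s ∈ Icc t (t + dt), |derivWithin f (Icc 0 T) s - v| ≤ K * dt := fun s hs => by
    rw [← hveq]
    have := (convex_Icc 0 T).norm_image_sub_le_of_norm_hasDerivWithin_le h2 hK htm (hsub hs)
    refine this.trans ?_
    rw [Real.norm_of_nonneg (by linarith [hs.1])]
    exact mul_le_mul_of_nonneg_left (by linarith [hs.2]) hK0
  have h4 := norm_image_sub_le_of_norm_deriv_le_segment' (f := fun s => f s - v * s)
    (f' := fun s => derivWithin f (Icc 0 T) s - v) (a := t) (b := t + dt) (C := K * dt)
    (fun s hs => by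
      exact (((h1 s (hsub hs)).mono hsub).sub
        ((hasDerivWithinAt_id s _).const_mul v)).congr_deriv (by simp))
    (fun s hs => h3 s (Ico_subset_Icc_self hs)) (t + dt) (right_mem_Icc.2 (by linarith))
  rw [add_sub_cancel_left, Real.norm_eq_abs] at h4
  have h5 : (f (t + dt) - f t) / dt - v = (f (t + dt) - v * (t + dt) - (f t - v * t)) / dt := by
    field_simp; ring
  rw [h5, abs_div, abs_of_pos hdt, div_le_iff₀ hdt]
  exact h4

/-- Points with |x_j| ≤ 3L/4 are at least L/4 from the boundary, and 4^α ≤ 16. The range 3L/4 leaves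
room for the barrier to rise outside the inner half. -/
theorem mul_tail_le {α h L : ℝ} (hα : 0 < α) (hα2 : α < 2) (hh : 0 < h) {J : ℕ} {j : ℤ}
    (hL : 1 ≤ L) (hJ : (J : ℝ) * h = L) (hj : |(j : ℝ) * h| ≤ 3 / 4 * L) :
    h * (h ^ (-(1 + α)) * ((J : ℝ) - |(j : ℝ)|) ^ (-α)) ≤ 16 * L ^ (-α) := by
  rw [abs_mul, abs_of_pos hh] at hj
  have h1 : 1 / 4 * L ≤ h * ((J : ℝ) - |(j : ℝ)|) := by nlinarith
  have h2 : 0 ≤ (J : ℝ) - |(j : ℝ)| := by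
    by_contra hneg
    push Not at hneg
    nlinarith
  rw [← mul_assoc, mul_rpow_neg_one_add hh, ← Real.mul_rpow hh.le h2]
  calc _ ≤ (1 / 4 * L) ^ (-α) := Real.rpow_le_rpow_of_nonpos (by linarith) h1 (by linarith)
    _ = 4 ^ α * L ^ (-α) := by
        rw [Real.mul_rpow (by norm_num) (by linarith), one_div, Real.inv_rpow (by norm_num),
          Real.rpow_neg (by norm_num), inv_inv]
    _ ≤ 4 ^ (2 : ℝ) * L ^ (-α) := by
        refine mul_le_mul_of_nonneg_right ?_ (Real.rpow_nonneg (by linarith) _)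
        exact Real.rpow_le_rpow_of_exponent_le (by norm_num) hα2.le
    _ = _ := by norm_num

theorem abs_int_lt_of_abs_mul_le {h L : ℝ} {J : ℕ} {j : ℤ} (hh : 0 < h)
    (hL : 1 ≤ L) (hJ : (J : ℝ) * h = L) (hj : |(j : ℝ) * h| ≤ 3 / 4 * L) : |j| < (J : ℤ) := by
  rw [abs_mul, abs_of_pos hh] at hj
  have : |(j : ℝ)| < J := by
    by_contra hneg
    push Not at hneg
    nlinarith
  exact_mod_cast this

/-- Consistency of the spatial discretisation away from the boundary. -/
theorem abs_spatial_error_le {α K M h L v : ℝ} {σ f : ℝ → ℝ} (hα : 0 < α) (hα2 : α < 2)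
    (hσ : ∀ x, |σ x| ≤ M)
    (hf : ContDiff ℝ 4 f) (hK : ∀ i ≤ 4, ∀ y, |iteratedDeriv i f y| ≤ K)
    (hh : 0 < h) (hh1 : h ≤ 1) {J : ℕ} {j : ℤ} (hL : 1 ≤ L) (hJ : (J : ℝ) * h = L)
    (hj : |(j : ℝ) * h| ≤ 3 / 4 * L) (hv : HasPVStable α f (j * h) v) :
    |(|σ (j * h)| ^ α * v) - discreteOp α σ h J (fun i : ℤ => f (i * h)) j| ≤
      stableConst α * M ^ α * ((8 + 320 * levyMass α + 4 * |realZeta (α - 1)|) +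
        64 * (1 + 1 / α)) * K * (h ^ 2 + L ^ (-α)) := by
  set x : ℝ := j * h with hx
  have hK0 : 0 ≤ K := (abs_nonneg _).trans (hK 0 (by norm_num) 0)
  have hD : ∀ i < 4, ∀ t, HasDerivAt (iteratedDeriv i f) (iteratedDeriv (i + 1) f t) t :=
    fun i hi t => hasDerivAt_iteratedDeriv (n := 4) (by exact_mod_cast hf) hi t
  have hfK : ∀ y, |f y| ≤ K := by simpa using hK 0 (by norm_num)
  have hsb : ∀ z, 0 < z → |secondDiff f x z| ≤ 4 * K * min 1 (z ^ 2) := fun z hz =>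
    abs_secondDiff_le (by simpa using hD 0 (by norm_num)) (hD 1 (by norm_num)) hfK
      (hK 2 (by norm_num)) x hz.le
  have hint := integrableOn_secondDiff hα hα2 hf.continuous hsb
  have hsum := summable_secondDiff hα hα2 hh hsb
  have hquad := modified_trapezoid_error_le (x := x) hα hα2 hf hK hh hh1
  have hveq := hv.eq_integral hint
  set S := ∑' k : ℕ, secondDiff f x ((k + 1) * h) * ((k + 1) * h) ^ (-(1 + α)) with hS
  set I := ∫ z in Ioi 0, secondDiff f x z * z ^ (-(1 + α)) with hI
  set P := primedSum α h J (fun i : ℤ => f (i * h)) j with hP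
  have hjJ := abs_int_lt_of_abs_mul_le hh hL hJ hj
  have hPS : |P - S| ≤ 4 * K * (1 + 1 / α) * h ^ (-(1 + α)) * ((J : ℝ) - |(j : ℝ)|) ^ (-α) := by
    refine le_of_tendsto ((hsum.hasSum.tendsto_sum_nat.const_sub P).abs) ?_
    filter_upwards [eventually_ge_atTop (2 * J)] with N hN
    have := abs_primedSum_sub_le hα hh (V := fun i : ℤ => f (i * h)) (fun i => hfK _) hjJ hN
    refine le_trans (le_of_eq ?_) this
    congr 2
    refine Finset.sum_congr rfl fun k _ => ?_
    simp only [secondDiff, hx]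
    push_cast
    rw [add_mul (j : ℝ), sub_mul (j : ℝ)]
  have htail : |h * P - h * S| ≤ 64 * (1 + 1 / α) * K * L ^ (-α) := by
    rw [← mul_sub, abs_mul, abs_of_pos hh]
    have h1 := mul_tail_le hα hα2 hh hL hJ hj
    have h2 : 0 ≤ 4 * K * (1 + 1 / α) := by positivity
    nlinarith [mul_le_mul_of_nonneg_left hPS hh.le, mul_le_mul_of_nonneg_left h1 h2]
  set c := stableConst α * |σ x| ^ α with hc
  have hc0 : 0 ≤ c := coeff_nonneg hα hα2 _
  have hcM : c ≤ stableConst α * M ^ α := coeff_le hα hα2 (hσ _)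
  have hsd : (f (((j + 1 : ℤ) : ℝ) * h) - 2 * f (j * h) + f (((j - 1 : ℤ) : ℝ) * h)) =
      secondDiff f x h := by
    simp only [secondDiff, hx]
    push_cast
    rw [add_mul, sub_mul, one_mul]
    ring
  -- Quadrature error of the untruncated rule, then the cost of truncating the sum.
  have hsplit : |σ x| ^ α * v - discreteOp α σ h J (fun i : ℤ => f (i * h)) j =
      c * (-(h * S - realZeta (α - 1) * h ^ (-α) * secondDiff f x h - I) - (h * P - h * S)) := by
    rw [discreteOp, ← hP, hsd, hveq, hc]
    ring
  have hm := levyMass_nonneg α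
  have hLα : 0 ≤ L ^ (-α) := Real.rpow_nonneg (by linarith) _
  set A := 8 + 320 * levyMass α + 4 * |realZeta (α - 1)| with hA
  have hA0 : 0 ≤ A := by positivity
  rw [hsplit, abs_mul, abs_of_nonneg hc0]
  calc _ ≤ c * (A * K * h ^ 2 + 64 * (1 + 1 / α) * K * L ^ (-α)) := by
        refine mul_le_mul_of_nonneg_left ((abs_sub _ _).trans ?_) hc0
        rw [abs_neg]
        exact add_le_add hquad htail
    _ ≤ stableConst α * M ^ α * (A * K * h ^ 2 + 64 * (1 + 1 / α) * K * L ^ (-α)) :=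
        mul_le_mul_of_nonneg_right hcM (by positivity)
    _ ≤ stableConst α * M ^ α * ((A + 64 * (1 + 1 / α)) * K * (h ^ 2 + L ^ (-α))) := by
        refine mul_le_mul_of_nonneg_left ?_ (hc0.trans hcM)
        have : 0 ≤ A * K * L ^ (-α) := by positivity
        have : 0 ≤ 64 * (1 + 1 / α) * K * h ^ 2 := by positivity
        nlinarith
    _ = _ := by ring

/-- Consistency is needed wherever the barrier is not yet saturated, hence up to 3L/4 rather than
L/2. -/
theorem exists_truncError_le {α T M : ℝ} {σ : ℝ → ℝ} {u : ℝ → ℝ → ℝ} (hα : 0 < α) (hα2 : α < 2)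
    (hM : 0 < M) (hσ : ∀ x, |σ x| ≤ M) (hT : 0 < T) (hu : IsClassicalSolution α σ T u)
    (hreg : IsRegular T u) :
    ∃ C : ℝ, 0 ≤ C ∧ ∀ (dt h L : ℝ) (J : ℕ), 0 < dt → 0 < h → h ≤ 1 → 1 ≤ L → (J : ℝ) * h = L →
      ∀ (n : ℕ) (j : ℤ), ((n : ℝ) + 1) * dt ≤ T → |(j : ℝ) * h| ≤ 3 / 4 * L →
        |truncError α σ u dt h J n j| ≤ C * (dt + h ^ 2 + L ^ (-α)) := by
  obtain ⟨hct, hcx, K, hK⟩ := hreg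
  have hK0 : 0 ≤ K := (abs_nonneg _).trans ((hK 0 0 ⟨le_rfl, hT.le⟩).1 0 (by norm_num))
  have hm := levyMass_nonneg α
  have hc := stableConst_pos hα hα2
  set B := stableConst α * M ^ α * ((8 + 320 * levyMass α + 4 * |realZeta (α - 1)|) +
        64 * (1 + 1 / α)) * K with hB
  have hB0 : 0 ≤ B := by positivity
  refine ⟨K + B, by positivity, ?_⟩
  intro dt h L J hdt hh hh1 hL hJ n j hn hj
  have hnt : 0 ≤ (n : ℝ) * dt := by positivity
  have hn' : (n : ℝ) * dt + dt ≤ T := by linarith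
  have htm : (n : ℝ) * dt ∈ Icc 0 T := ⟨hnt, by linarith⟩
  obtain ⟨v, hv, hd⟩ := hu (j * h) (n * dt) htm
  have h1 := abs_forward_diff_sub_le hT (hct (j * h)) (fun s hs => (hK (j * h) s hs).2) hnt hdt hn' hd
  have h2 := abs_spatial_error_le hα hα2 hσ (hcx _ htm) (fun i hi y => (hK y _ htm).1 i hi)
    hh hh1 hL hJ hj hv
  rw [← hB] at h2
  have hLα : 0 ≤ L ^ (-α) := Real.rpow_nonneg (by linarith) _
  have hsplit : truncError α σ u dt h J n j =
      ((u (j * h) (n * dt + dt) - u (j * h) (n * dt)) / dt - |σ (j * h)| ^ α * v) +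
      (|σ (j * h)| ^ α * v - discreteOp α σ h J (fun i : ℤ => u (i * h) (n * dt)) j) := by
    rw [truncError, show ((n : ℝ) + 1) * dt = n * dt + dt by ring]
    ring
  rw [hsplit]
  refine (abs_add_le _ _).trans ((add_le_add h1 h2).trans ?_)
  have : 0 ≤ K * (h ^ 2 + L ^ (-α)) := by positivity
  have : 0 ≤ B * dt := by positivity
  nlinarith

/-! ### The barrier and the convergence proof -/

/-- A semiconcave cutoff, equal to `0` on `[-1/2, 1/2]` and to `1` outside `[-3/4, 3/4]`. -/
def farCutoff (y : ℝ) : ℝ := min 1 (16 * (y - max (-1 / 2) (min y (1 / 2))) ^ 2)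

theorem farCutoff_nonneg (y : ℝ) : 0 ≤ farCutoff y := le_min zero_le_one (by positivity)

theorem farCutoff_le_one (y : ℝ) : farCutoff y ≤ 1 := min_le_left _ _

theorem farCutoff_eq_zero {y : ℝ} (hy : |y| ≤ 1 / 2) : farCutoff y = 0 := by
  have := abs_le.1 hy
  rw [farCutoff, min_eq_left this.2, max_eq_right (by linarith), sub_self]
  simp

theorem farCutoff_eq_one {y : ℝ} (hy : 3 / 4 ≤ |y|) : farCutoff y = 1 := by
  rw [farCutoff, min_eq_left]
  rcases le_abs.1 hy with h | h
  · rw [min_eq_right (by linarith), max_eq_right (by norm_num)]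
    nlinarith
  · rw [min_eq_left (by linarith), max_eq_left (by linarith)]
    nlinarith

/-- The cutoff is 16 times the squared distance to [-1/2, 1/2], capped at 1, so replacing the
nearest point by any other point p of that interval only increases the value. With p nearest to y,
this parabola touches the uncapped function from above at y. -/
theorem farCutoff_le_sq (y p : ℝ) (hp : |p| ≤ 1 / 2) : farCutoff y ≤ 16 * (y - p) ^ 2 := by
  have hp' := abs_le.1 hp
  refine (min_le_right _ _).trans ?_
  rcases le_total y (1 / 2) with h | h
  · rw [min_eq_left h]
    rcases le_total (-1 / 2) y with h' | h'
    · rw [max_eq_right h']; nlinarith [sq_nonneg (y - p)]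
    · rw [max_eq_left h']; nlinarith
  · rw [min_eq_right h, max_eq_right (by norm_num)]; nlinarith

/-- At every point the cutoff is touched from above by a constant or by a parabola 16(· - p)², whose
second difference is 32z². Only an upper bound is needed, so the concave corners at ±3/4 do no harm.
-/
theorem secondDiff_farCutoff_le (y z : ℝ) : secondDiff farCutoff y z ≤ 32 * min 1 (z ^ 2) := by
  have hm : 0 ≤ min 1 (z ^ 2) := le_min zero_le_one (sq_nonneg z)
  have h1 := farCutoff_le_one (y + z)
  have h2 := farCutoff_le_one (y - z)
  have h0 := farCutoff_nonneg y
  rw [mul_min_of_nonneg _ _ (by norm_num : (0 : ℝ) ≤ 32)]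
  refine le_min (by rw [secondDiff]; linarith) ?_
  rcases min_choice 1 (16 * (y - max (-1 / 2) (min y (1 / 2))) ^ 2) with h | h
  · have : farCutoff y = 1 := h
    rw [secondDiff, this]
    nlinarith [sq_nonneg z]
  · have hy : farCutoff y = 16 * (y - max (-1 / 2) (min y (1 / 2))) ^ 2 := h
    set p := max (-1 / 2) (min y (1 / 2)) with hp
    have hpb : |p| ≤ 1 / 2 := abs_le.2 ⟨by have := le_max_left (-1 / 2) (min y (1 / 2)); linarith,
      max_le (by norm_num) (min_le_right _ _)⟩
    have h3 := farCutoff_le_sq (y + z) p hpb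
    have h4 := farCutoff_le_sq (y - z) p hpb
    rw [secondDiff, hy]
    nlinarith

/-- In the variable x/L the mesh is h/L ≤ 1, and the homogeneity of the kernel releases the factor
L^{-α}. The rescaled Riemann sum is bounded uniformly by `sum_levyWeight_le`; the correction term
has the right sign because -ζ(α-1) > 0. -/
theorem exists_discreteOp_farCutoff_le {α M : ℝ} {σ : ℝ → ℝ} (hα : 0 < α) (hα2 : α < 2)
    (hM : 0 < M) (hσ : ∀ x, |σ x| ≤ M) :
    ∃ C : ℝ, 0 ≤ C ∧ ∀ (h L : ℝ) (J : ℕ), 0 < h → h ≤ 1 → 1 ≤ L → (J : ℝ) * h = L →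
      ∀ j : ℤ, |(j : ℝ) * h| ≤ 3 / 4 * L →
        discreteOp α σ h J (fun i : ℤ => farCutoff (i * h / L)) j ≤ C * L ^ (-α) := by
  have hz : realZeta (α - 1) < 0 := realZeta_neg (by linarith) (by linarith)
  have hcpos := stableConst_pos hα hα2
  have hm := levyMass_nonneg α
  set B := 32 * (-realZeta (α - 1)) + (256 * levyMass α + 64 * (1 + 1 / α)) with hB
  have hB0 : 0 ≤ B := by
    have : 0 < -realZeta (α - 1) := by linarith
    positivity
  refine ⟨stableConst α * M ^ α * B, by positivity, ?_⟩
  intro h L J hh hh1 hL hJ j hj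
  have hL0 : 0 < L := by linarith
  have hhL : 0 < h / L := by positivity
  have hhL1 : h / L ≤ 1 := (div_le_one hL0).2 (hh1.trans hL)
  have hLα : 0 ≤ L ^ (-α) := Real.rpow_nonneg hL0.le _
  set V : ℤ → ℝ := fun i => farCutoff (i * h / L) with hV
  have hjJ := abs_int_lt_of_abs_mul_le hh hL hJ hj
  have hVd : ∀ k : ℕ, V (j + ((k : ℤ) + 1)) + V (j - ((k : ℤ) + 1)) - 2 * V j =
      secondDiff farCutoff (j * h / L) ((k + 1) * (h / L)) := fun k => by
    simp only [hV, secondDiff]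
    push_cast
    congr 3
    all_goals ring_nf
  have htail := abs_primedSum_sub_le hα hh (V := V) (K := 1)
    (fun i => by rw [abs_of_nonneg (farCutoff_nonneg _)]; exact farCutoff_le_one _) hjJ
    (le_refl (2 * J))
  set P := primedSum α h J V j with hP
  have hsum : h * ∑ k ∈ Finset.range (2 * J), (V (j + ((k : ℤ) + 1)) + V (j - ((k : ℤ) + 1)) -
      2 * V j) * ((k + 1) * h) ^ (-(1 + α)) ≤ 256 * levyMass α * L ^ (-α) := by
    have hterm : ∀ k : ℕ, h * ((V (j + ((k : ℤ) + 1)) + V (j - ((k : ℤ) + 1)) - 2 * V j) *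
        ((k + 1) * h) ^ (-(1 + α))) ≤
        32 * L ^ (-α) * (h / L * levyWeight α ((k + 1) * (h / L))) := fun k => by
      have hk : 0 < ((k : ℝ) + 1) * (h / L) := by positivity
      have e1 : (((k : ℝ) + 1) * h) ^ (-(1 + α)) =
          (((k : ℝ) + 1) * (h / L)) ^ (-(1 + α)) * L ^ (-(1 + α)) := by
        rw [← Real.mul_rpow hk.le hL0.le]
        congr 1
        field_simp
      have e2 := mul_rpow_neg_one_add (α := α) hL0
      rw [hVd, e1, levyWeight, ← e2]
      have h1 := secondDiff_farCutoff_le (j * h / L) ((k + 1) * (h / L))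
      have h2 : 0 ≤ h * ((((k : ℝ) + 1) * (h / L)) ^ (-(1 + α)) * L ^ (-(1 + α))) := by positivity
      have h3 := mul_le_mul_of_nonneg_right h1 h2
      refine le_trans (le_of_eq ?_) (h3.trans (le_of_eq ?_))
      · ring
      · field_simp
    rw [Finset.mul_sum]
    refine (Finset.sum_le_sum fun k _ => hterm k).trans ?_
    rw [← Finset.mul_sum]
    have := mul_le_mul_of_nonneg_left (sum_levyWeight_le hα hα2 hhL (2 * J))
      (show 0 ≤ 32 * L ^ (-α) by positivity)
    linarith
  have hPb : h * P ≤ (256 * levyMass α + 64 * (1 + 1 / α)) * L ^ (-α) := by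
    have h1 := mul_tail_le hα hα2 hh hL hJ hj
    have h2 : 0 ≤ 4 * (1 + 1 / α) := by positivity
    have h3 := mul_le_mul_of_nonneg_left h1 h2
    have h4 := mul_le_mul_of_nonneg_left (le_of_abs_le htail) hh.le
    nlinarith
  have hnear : h ^ (-α) * (V (j + 1) - 2 * V j + V (j - 1)) ≤ 32 * L ^ (-α) := by
    have h1 := hVd 0
    simp only [Nat.cast_zero, zero_add, one_mul] at h1
    have h2 : V (j + 1) - 2 * V j + V (j - 1) ≤ 32 * (h / L) ^ 2 := by
      have := (secondDiff_farCutoff_le (j * h / L) (h / L)).trans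
        (mul_le_mul_of_nonneg_left (min_le_right _ _) (by norm_num))
      linarith
    have hhα := Real.rpow_nonneg hh.le (-α)
    have e1 : h ^ (-α) * (h / L) ^ 2 = (h / L) ^ (2 - α) * L ^ (-α) := by
      rw [show (2 : ℝ) - α = 2 + (-α) by ring, Real.rpow_add hhL, Real.rpow_two, mul_assoc,
        ← Real.mul_rpow hhL.le hL0.le, div_mul_cancel₀ _ hL0.ne', mul_comm]
    have e2 : (h / L) ^ (2 - α) ≤ 1 := Real.rpow_le_one hhL.le hhL1 (by linarith)
    nlinarith [mul_le_mul_of_nonneg_left h2 hhα, mul_le_mul_of_nonneg_right e2 hLα]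
  set c := stableConst α * |σ (j * h)| ^ α with hc
  have hc0 : 0 ≤ c := coeff_nonneg hα hα2 _
  have hcM : c ≤ stableConst α * M ^ α := coeff_le hα hα2 (hσ _)
  have hop : discreteOp α σ h J V j =
      c * (-realZeta (α - 1) * (h ^ (-α) * (V (j + 1) - 2 * V j + V (j - 1))) + h * P) := by
    rw [discreteOp, ← hc, ← hP]; ring
  rw [hop]
  calc _ ≤ c * (-realZeta (α - 1) * (32 * L ^ (-α)) +
          (256 * levyMass α + 64 * (1 + 1 / α)) * L ^ (-α)) := by
        refine mul_le_mul_of_nonneg_left (add_le_add ?_ hPb) hc0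
        exact mul_le_mul_of_nonneg_left hnear (by linarith)
    _ = c * (B * L ^ (-α)) := by rw [hB]; ring
    _ ≤ stableConst α * M ^ α * (B * L ^ (-α)) :=
        mul_le_mul_of_nonneg_right hcM (by positivity)
    _ = _ := by ring

/-- The local Euler error recursion. -/
theorem numSol_succ_sub_eq {α dt h : ℝ} (σ : ℝ → ℝ) (u : ℝ → ℝ → ℝ) (hdt : 0 < dt)
    {J : ℕ} (n : ℕ) {j : ℤ} (hj : |j| < (J : ℤ)) :
    numSol α σ (fun x => u x 0) dt h J (n + 1) j - u (j * h) (((n + 1 : ℕ) : ℝ) * dt) =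
      (numSol α σ (fun x => u x 0) dt h J n j - u (j * h) (n * dt)) +
        dt * discreteOp α σ h J
          (fun i => numSol α σ (fun x => u x 0) dt h J n i - u (i * h) (n * dt)) j -
        dt * truncError α σ u dt h J n j := by
  rw [numSol, if_pos hj, discreteOp_sub, truncError]
  push_cast
  field_simp
  ring

/-- Barrier argument: the far-field error reaches the inner half only at order `L^{-α}`. -/
theorem error_le_barrier {α M dt h L K A T : ℝ} {σ : ℝ → ℝ} (hα : 0 < α) (hα2 : α < 2)
    (hM : 0 < M) (hσ : ∀ x, |σ x| ≤ M) (hdt : 0 < dt) (hh : 0 < h) (hL : 1 ≤ L)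
    {J : ℕ} (hJ : (J : ℝ) * h = L) (hcfl : CFL α M dt h) (hA : 0 ≤ A)
    {e τ : ℕ → ℤ → ℝ} (he : ∀ (n : ℕ) j, (n : ℝ) * dt ≤ T → e n j ≤ 2 * K) (hK : 0 ≤ K)
    (he0 : ∀ j, |j| < (J : ℤ) → e 0 j ≤ 0)
    (hstep : ∀ n j, |j| < (J : ℤ) →
      e (n + 1) j = e n j + dt * discreteOp α σ h J (e n) j + dt * τ n j)
    (hA' : ∀ (n : ℕ) (j : ℤ), ((n : ℝ) + 1) * dt ≤ T → |(j : ℝ) * h| ≤ 3 / 4 * L →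
      2 * K * discreteOp α σ h J (fun i : ℤ => farCutoff (i * h / L)) j + τ n j ≤ A)
    (n : ℕ) (hn : (n : ℝ) * dt ≤ T) (j : ℤ) :
    e n j ≤ 2 * K * farCutoff (j * h / L) + n * dt * A := by
  have hL0 : 0 < L := by linarith
  -- Where the cutoff equals 1 the barrier exceeds the a priori bound 2K, so the recursion is never
  -- needed near or beyond the boundary.
  have hfar : ∀ (n : ℕ) (j : ℤ), (n : ℝ) * dt ≤ T → 3 / 4 * L ≤ |(j : ℝ) * h| →
      e n j ≤ 2 * K * farCutoff (j * h / L) + n * dt * A := fun n j hn hj => by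
    rw [farCutoff_eq_one (by rw [abs_div, abs_of_pos hL0, le_div_iff₀ hL0]; exact hj), mul_one]
    have : 0 ≤ n * dt * A := by positivity
    linarith [he n j hn]
  induction n generalizing j with
  | zero =>
    rcases le_total (3 / 4 * L) |(j : ℝ) * h| with hj | hj
    · exact hfar 0 j hn hj
    · refine (he0 j (abs_int_lt_of_abs_mul_le hh hL hJ hj)).trans ?_
      have := farCutoff_nonneg (j * h / L)
      simp only [Nat.cast_zero, zero_mul, add_zero]
      positivity
  | succ n ih =>
    rcases le_total (3 / 4 * L) |(j : ℝ) * h| with hj | hj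
    · exact hfar (n + 1) j hn hj
    · have hjJ := abs_int_lt_of_abs_mul_le hh hL hJ hj
      push_cast at hn ⊢
      -- The nonlocal step sees all grid points, so the induction hypothesis is used globally. The
      -- constant n·dt·A disappears under the operator, and the increment dt·A pays for the cutoff
      -- term and the residual.
      have h1 := euler_step_mono hα hα2 hM hσ hdt hh hcfl (J := J)
        (fun i => ih (by linarith) i) hjJ.le
      rw [discreteOp_mul_add_const] at h1
      have h2 := mul_le_mul_of_nonneg_left (hA' n j hn hj) hdt.le
      rw [hstep n j hjJ]
      linarith

theorem exists_numSol_error_le {α T M : ℝ} {σ : ℝ → ℝ} {u : ℝ → ℝ → ℝ} (hα : 0 < α) (hα2 : α < 2)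
    (hM : 0 < M) (hσ : ∀ x, |σ x| ≤ M) (hT : 0 < T) (hu : IsClassicalSolution α σ T u)
    (hreg : IsRegular T u) :
    ∃ C : ℝ, ∀ (dt h L : ℝ) (J : ℕ), 0 < dt → 0 < h → h ≤ 1 → 1 ≤ L → (J : ℝ) * h = L →
      CFL α M dt h →
      ∀ (n : ℕ) (j : ℤ), (n : ℝ) * dt ≤ T → |(j : ℝ) * h| ≤ L / 2 →
        |numSol α σ (fun x => u x 0) dt h J n j - u ((j : ℝ) * h) ((n : ℝ) * dt)| ≤
          C * (dt + h ^ 2 + L ^ (-α)) := by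
  obtain ⟨C₁, hC₁, htr⟩ := exists_truncError_le hα hα2 hM hσ hT hu hreg
  obtain ⟨C₂, hC₂, hcut⟩ := exists_discreteOp_farCutoff_le hα hα2 hM hσ
  obtain ⟨-, -, K, hK⟩ := hreg
  have huK : ∀ x, ∀ t ∈ Icc 0 T, |u x t| ≤ K := fun x t ht => by
    simpa using (hK x t ht).1 0 (by norm_num)
  have h0 : (0 : ℝ) ∈ Icc 0 T := ⟨le_rfl, hT.le⟩
  have hK0 : 0 ≤ K := (abs_nonneg _).trans (huK 0 0 h0)
  -- The barrier grows at rate A = (2K C₂ + C₁)R, the cutoff cost plus the truncation error, over a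
  -- time at most T.
  refine ⟨T * (2 * K * C₂ + C₁), ?_⟩
  intro dt h L J hdt hh hh1 hL hJ hcfl n j hn hj
  have hL0 : 0 < L := by linarith
  have hLα : 0 ≤ L ^ (-α) := Real.rpow_nonneg hL0.le _
  set R := dt + h ^ 2 + L ^ (-α) with hR
  have hR0 : 0 ≤ R := by positivity
  have hLR : L ^ (-α) ≤ R := by nlinarith [sq_nonneg h]
  set e : ℕ → ℤ → ℝ := fun n j => numSol α σ (fun x => u x 0) dt h J n j - u (j * h) (n * dt) with he
  have heK : ∀ (n : ℕ) j, (n : ℝ) * dt ≤ T → |e n j| ≤ 2 * K := fun n j hn => by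
    have h1 := abs_numSol_le hα hα2 hM hσ hdt hh hcfl (fun x => huK x 0 h0) J n j
    have h2 := huK (j * h) (n * dt) ⟨by positivity, hn⟩
    exact (abs_sub _ _).trans (by linarith)
  have he0 : ∀ j, |j| < (J : ℤ) → e 0 j = 0 := fun j hj => by
    simp [he, numSol, hj]
  have hstep : ∀ n j, |j| < (J : ℤ) → e (n + 1) j =
      e n j + dt * discreteOp α σ h J (e n) j - dt * truncError α σ u dt h J n j :=
    fun n j hj => numSol_succ_sub_eq σ u hdt n hj
  set A := (2 * K * C₂ + C₁) * R with hA
  have hA0 : 0 ≤ A := by positivity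
  have hop : ∀ j : ℤ, |(j : ℝ) * h| ≤ 3 / 4 * L →
      2 * K * discreteOp α σ h J (fun i : ℤ => farCutoff (i * h / L)) j ≤ 2 * K * C₂ * R :=
    fun j hj => by
      have h1 := (hcut h L J hh hh1 hL hJ j hj).trans (mul_le_mul_of_nonneg_left hLR hC₂)
      have := mul_le_mul_of_nonneg_left h1 (show 0 ≤ 2 * K by positivity)
      linarith
  have hup := error_le_barrier (e := e) (τ := fun n j => -truncError α σ u dt h J n j)
    hα hα2 hM hσ hdt hh hL hJ hcfl hA0 (fun n j hn => (abs_le.1 (heK n j hn)).2) hK0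
    (fun j hj => (he0 j hj).le) (fun n j hj => by rw [hstep n j hj]; ring)
    (fun n j hn hj => by
      have h1 := (abs_le.1 (htr dt h L J hdt hh hh1 hL hJ n j hn hj)).1
      have h2 := hop j hj
      rw [hA]; linarith) n hn j
  -- The recursion is linear, so the same barrier bounds -e, with the residual reversed in sign.
  have hlow := error_le_barrier (e := fun n j => -e n j)
    (τ := fun n j => truncError α σ u dt h J n j)
    hα hα2 hM hσ hdt hh hL hJ hcfl hA0
    (fun n j hn => by have := (abs_le.1 (heK n j hn)).1; linarith) hK0
    (fun j hj => by rw [he0 j hj, neg_zero])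
    (fun n j hj => by
      have := discreteOp_mul_add_const α σ h J (-1) 0 (e n) j
      simp only [neg_mul, one_mul, add_zero] at this
      rw [hstep n j hj, this]; ring)
    (fun n j hn hj => by
      have h1 := (abs_le.1 (htr dt h L J hdt hh hh1 hL hJ n j hn hj)).2
      have h2 := hop j hj
      rw [hA]; linarith) n hn j
  rw [farCutoff_eq_zero (by rw [abs_div, abs_of_pos hL0, div_le_iff₀ hL0]; linarith), mul_zero,
    zero_add] at hup hlow
  have hfin : (n : ℝ) * dt * A ≤ T * (2 * K * C₂ + C₁) * R := by
    rw [mul_assoc T]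
    exact mul_le_mul_of_nonneg_right hn hA0
  exact abs_le.2 ⟨by linarith, by linarith⟩

end NonlocalFPE

end

theorem proposition3p3
    (α : ℝ) (hα0 : 0 < α) (hα2 : α < 2)
    (σ : ℝ → ℝ) (Mσ : ℝ) (hMσ : 0 < Mσ) (hσ : ∀ x : ℝ, |σ x| ≤ Mσ)
    (T : ℝ) (hT : 0 < T) (u : ℝ → ℝ → ℝ)
    (hu : NonlocalFPE.IsClassicalSolution α σ T u) (hreg : NonlocalFPE.IsRegular T u) :
    -- truncation error
    (∃ C : ℝ, ∀ (dt h L : ℝ) (J : ℕ), 0 < dt → 0 < h → h ≤ 1 → 1 ≤ L → (J : ℝ) * h = L →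
      ∀ (n : ℕ) (j : ℤ), ((n : ℝ) + 1) * dt ≤ T → |(j : ℝ) * h| ≤ L / 2 →
        |NonlocalFPE.truncError α σ u dt h J n j| ≤ C * (dt + h ^ 2 + L ^ (-α))) ∧
    -- the same rate for the error of the numerical solution
    (∃ C : ℝ, ∀ (dt h L : ℝ) (J : ℕ), 0 < dt → 0 < h → h ≤ 1 → 1 ≤ L → (J : ℝ) * h = L →
      NonlocalFPE.CFL α Mσ dt h →
      ∀ (n : ℕ) (j : ℤ), (n : ℝ) * dt ≤ T → |(j : ℝ) * h| ≤ L / 2 →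
        |NonlocalFPE.numSol α σ (fun x => u x 0) dt h J n j - u ((j : ℝ) * h) ((n : ℝ) * dt)| ≤
          C * (dt + h ^ 2 + L ^ (-α))) ∧
    -- uniform convergence along every refinement path that satisfies the CFL condition
    (∀ (dt h L : ℕ → ℝ) (J : ℕ → ℕ),
      (∀ m : ℕ, 0 < dt m ∧ 0 < h m ∧ (J m : ℝ) * h m = L m ∧
        NonlocalFPE.CFL α Mσ (dt m) (h m)) →
      Tendsto dt atTop (𝓝 0) → Tendsto h atTop (𝓝 0) → Tendsto L atTop atTop →
      ∀ ε : ℝ, 0 < ε → ∀ᶠ m in atTop, ∀ (n : ℕ) (j : ℤ),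
        (n : ℝ) * dt m ≤ T → |(j : ℝ) * h m| ≤ L m / 2 →
          |NonlocalFPE.numSol α σ (fun x => u x 0) (dt m) (h m) (J m) n j -
            u ((j : ℝ) * h m) ((n : ℝ) * dt m)| < ε) := by
  refine ⟨?_, ?_, ?_⟩
  · obtain ⟨C, -, hC⟩ := NonlocalFPE.exists_truncError_le hα0 hα2 hMσ hσ hT hu hreg
    exact ⟨C, fun dt h L J hdt hh hh1 hL hJ n j hn hj =>
      hC dt h L J hdt hh hh1 hL hJ n j hn (by linarith)⟩
  · exact NonlocalFPE.exists_numSol_error_le hα0 hα2 hMσ hσ hT hu hreg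
  · obtain ⟨C, hC⟩ := NonlocalFPE.exists_numSol_error_le hα0 hα2 hMσ hσ hT hu hreg
    intro dt h L J hp hdt hh hL ε hε
    have hlim : Tendsto (fun m => C * (dt m + h m ^ 2 + L m ^ (-α))) atTop (𝓝 0) := by
      simpa using
        ((hdt.add (hh.pow 2)).add ((tendsto_rpow_neg_atTop hα0).comp hL)).const_mul C
    -- The restrictions h ≤ 1 and L ≥ 1 of the error estimate hold eventually along the path.
    filter_upwards [hlim.eventually_lt_const hε, hL.eventually_ge_atTop 1,
      hh.eventually_le_const one_pos] with m hm hLm hhm n j hn hj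
    obtain ⟨h1, h2, h3, h4⟩ := hp m
    exact (hC (dt m) (h m) (L m) (J m) h1 h2 hhm hLm h3 h4 n j hn hj).trans_lt hm
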